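/- **Games.** A negative game $A$ consists of a set $M_A$ of moves, a labelling $\lambda_A:M_A\to\{O,P\}$, a nonempty prefix-closed set $P_A$ of finite sequences of moves that start (if nonempty) with an $O$-move and alternate between $O$- and $P$-moves, and a set $W_A$ of infinite sequences all of whose finite prefixes lie in $P_A$ (the infinite plays won by $P$). A finite play is won by $P$ if it is empty or ends in a $P$-move. A strategy on $A$ is a nonempty $\sigma\subseteq P_A$ such that $sa\in\sigma$ implies $\lambda_A(a)=P$, $sab\in\sigma$ implies $s\in\sigma$, and $sa,sb\in\sigma$ implies $a=b$. It is winning if (totality) for all $s\in\sigma$ and $sa\in P_A$ there is $b$ with $sab\in\sigma$, and every infinite play all of whose prefixes ending in a $P$-move lie in $\sigma$ belongs to $W_A$. The game $A\multimap B$ has moves $M_A+M_B$, with the labels of $A$ exchanged; its plays are the alternating sequences, starting with an $O$-move, whose restrictions to $A$ and $B$ are plays; an infinite play is won by $P$ if its restriction to $B$ is won by $P$ or its restriction to $A$ is not won by $P$. Negative games and strategies on $A\multimap B$, ordered by inclusion, form a poset-enriched category $\mathcal G$: the composite of $\sigma:A\to B$ and $\tau:B\to C$ is $\{s|_{A,C}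 : s\in(M_A+M_B+M_C)^*,\ s|_{A,B}\in\sigma,\ s|_{B,C}\in\tau\}$, and the identity is the copycat strategy (the even-length plays of $A\multimap A$ all of whose even-length prefixes have equal restrictions to the two copies). Winning strategies are closed under composition and contain the identities. For a family $(N_i)_{i\in I}$ of negative games, $\prod_{i\in I} N_i$ has as finite plays the empty play and the tagged plays of the $N_i$, and as infinite plays won by $P$ the tagged elements of the $W_{N_i}$; $\pi_i:\prod_i N_i\to N_i$ is the copycat strategy and $\langle\sigma_i\rangle_i:A\to\prod_i N_i$ is the pairing of $\sigma_i:A\to N_i$. **Uniform winning strategies.** $\mathcal G_e$ has negative games as objects; an arrow $f:A\to B$ is a pair $(i_f,p_f)$ of arrows $i_f:A\to B$, $p_f:B\to A$ of $\mathcal G$ with $p_f\circ i_f=\mathrm{id}$ and $i_f\circ p_f\subseteq\mathrm{id}$. For a category $\mathcal C$, $\mathcal W^{\mathcal C}$ has as objects the functors $\mathcal C\to\mathcal G_e$, and as arrows $F\to G$ the families $\sigma$ of winning strategies $\sigma_c:F(c)\to G(c)$ with $i_{G(f)}\circ\sigma_c\subseteq\sigma_d\circ i_{F(f)}$ for all $f:c\to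 d$, composed componentwise. **Models.** Let $\mathcal L$ be a first-order language with complementary pairs $(\phi,\bar\phi)$ of predicate symbols ($\phi$ negative, $\bar\phi$ positive), among them the pair $(=,\neq)$. Let $\mathcal V$ be a set of variables, $X\subseteq\mathcal V$, $x\in\mathcal V\setminus X$, and $\Theta$ a set of atomic formulas with variables in $X$. Objects of $\mathcal M_X^\Theta$ are pairs $(L,v)$ of an $\mathcal L$-structure $L$ (on a set $|L|$, complementary predicates being interpreted by complementary relations, and $=$ by equality) and a valuation $v:X\to|L|$ that satisfy $\Theta$; arrows $(L,v)\to(L',v')$ are maps $f:|L|\to|L'|$ with $v'=f\circ v$ that commute with the function symbols and preserve the truth of the positive predicates $\bar\phi$ (including $\neq$, so $f$ is injective). Let $\mathcal M_{X\uplus\{x\}}^\Theta$ be defined likewise over $X\uplus\{x\}$, let $U_x:\mathcal M_{X\uplus\{x\}}^\Theta\to\mathcal M_X^\Theta$ be the functor that forgets the value of $x$, and let $U'_x:\mathcal W^{\mathcal M_X^\Theta}\to\mathcal W^{\mathcal M_{X\uplus\{x\}}^\Theta}$ be $F\mapsto F\circ U_x$, $\sigma\mapsto(\sigma_{U_x(L,v)})_{(L,v)}$.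 **Quantifier.** $\mathsf{FamInj}(\mathcal C)$ has set-indexed families of objects of $\mathcal C$ as objects; an arrow $(A_i)_{i\in I}\to(B_j)_{j\in J}$ is an injection $f:I\to J$ with arrows $f_i:A_i\to B_{f(i)}$. A functor $F:\mathcal C\to\mathcal D$ acts on families memberwise, giving $\mathsf{FamInj}(F)$. The functor $\mathsf{add}_x:\mathcal M_X^\Theta\to\mathsf{FamInj}(\mathcal M_{X\uplus\{x\}}^\Theta)$ sends $(L,v)$ to $((L,v[x\mapsto l]))_{l\in|L|}$ and $f$ to $(f,(f)_l)$. The functor $\mathsf{prod}:\mathsf{FamInj}(\mathcal G_e)\to\mathcal G_e$ sends a family to its product, and $(f,(f_j)):(G_j)_{j\in J}\to(H_h)_{h\in H}$ to the pair with embedding $\langle g_h\rangle_h$, where $g_h=i_{f_j}\circ\pi_j$ if $h=f(j)$ and $g_h=\{\varepsilon\}$ if $h\notin f(J)$, and projection $\langle p_{f_j}\circ\pi_{f(j)}\rangle_j$. Define $\forall x.\_:\mathcal W^{\mathcal M_{X\uplus\{x\}}^\Theta}\to\mathcal W^{\mathcal M_X^\Theta}$ by $\forall x.F=\mathsf{prod}\circ\mathsf{FamInj}(F)\circ\mathsf{add}_x$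 on objects and $(\forall x.\sigma)_{(L,v)}=\langle\sigma_{(L,v[x\mapsto l])}\circ\pi_l\rangle_{l\in|L|}$ on arrows. **Proposition.** The functor $\forall x.\_$ is a right adjoint of $U'_x$, and there is an adjunction $U'_x\dashv\forall x.\_$ whose counit $U'_x(\forall x.F)\to F$ has, at each $(L,v)$ in $\mathcal M_{X\uplus\{x\}}^\Theta$, the component $\pi_{v(x)}:\prod_{l\in|L|}F(L,v[x\mapsto l])\to F(L,v[x\mapsto v(x)])=F(L,v)$. -/

import Mathlib

open CategoryTheory

set_option linter.unusedSimpArgs false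

namespace WS1

universe u v w v' w'

/-! ### Games and strategies -/

/-- Opponent and Player. -/
inductive Player
  | O
  | P

/-- Exchange of the two players. -/
def Player.swap : Player → Player
  | .O => .P
  | .P => .O

/-- The finite prefix of length `n` of an infinite sequence. -/
def pre {α : Type*} (s : ℕ → α) (n : ℕ) : List α := (List.range n).map s

/-- The player who has to make the move number `n` (counted from `0`) when Opponent starts. -/
def turn (n : ℕ) : Player := if Even n then .O else .P

/-- A finite sequence of moves is alternating if it starts with an Opponent move (unless it is
empty) and alternates between Opponent moves and Player moves. -/
def Alternating {M : Type*} (lam : M → Player) (s : List M) : Prop :=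
  ∀ (k : ℕ) (hk : k < s.length), lam s[k] = turn k

/-- A negative game, that is, a game in which Opponent starts: a set of moves, their labelling, a
nonempty prefix-closed set of alternating finite sequences (the valid plays), and a set of infinite
sequences all of whose finite prefixes are valid plays (the infinite plays won by Player). -/
structure NegGame where
  Move : Type u
  lam : Move → Player
  plays : Set (List Move)
  plays_nonempty : plays.Nonempty
  plays_prefix : ∀ s t : List Move, s ++ t ∈ plays → s ∈ plays
  plays_alternating : ∀ s ∈ plays, Alternating lam s
  winning : Set (ℕ → Move)
  winning_plays : ∀ s ∈ winning, ∀ n, pre s n ∈ plays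

/-- A strategy on a negative game. -/
@[ext] structure Strategy (A : NegGame.{u}) where
  carrier : Set (List A.Move)
  subset_plays : ∀ s ∈ carrier, s ∈ A.plays
  last_player : ∀ s a, s ++ [a] ∈ carrier → A.lam a = .P
  prefix_closed : ∀ s a b, s ++ [a, b] ∈ carrier → s ∈ carrier
  deterministic : ∀ s a b, s ++ [a] ∈ carrier → s ++ [b] ∈ carrier → a = b
  nonempty : carrier.Nonempty

namespace Strategy

/-- Player can answer every move of Opponent. -/
def IsTotal {A : NegGame.{u}} (σ : Strategy A) : Prop :=
  ∀ s ∈ σ.carrier, ∀ a, s ++ [a] ∈ A.plays → ∃ b, s ++ [a, b] ∈ σ.carrier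

/-- A total strategy is winning if every infinite play, all of whose finite prefixes that end in a
Player move belong to the strategy, is won by Player. -/
def IsWinning {A : NegGame.{u}} (σ : Strategy A) : Prop :=
  σ.IsTotal ∧ ∀ s : ℕ → A.Move, (∀ n, pre s n ∈ A.plays) →
    (∀ n, A.lam (s n) = .P → pre s (n + 1) ∈ σ.carrier) → s ∈ A.winning

/-- Strategies on a game are ordered by inclusion. -/
instance {A : NegGame.{u}} : PartialOrder (Strategy A) :=
  PartialOrder.lift Strategy.carrier (fun _ _ h => Strategy.ext h)

end Strategy

/-- The finite plays won by Player: those that leave Opponent to move, i.e. the empty play and the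
plays that end in a Player move. -/
def NegGame.finWinning (A : NegGame.{u}) : Set (List A.Move) :=
  {s | s ∈ A.plays ∧ ∀ m ∈ s.getLast?, A.lam m = .P}

/-- For an infinite sequence `s` and a partial map `f` to moves of `A`, the restriction of `s`
along `f` (the sequence of the defined values of `f` on the members of `s`), which may be infinite
or finite, is won by Player in `A`. -/
def NegGame.WinsOn (A : NegGame.{u}) {α : Type*} (f : α → Option A.Move) (s : ℕ → α) : Prop :=
  (∃ t ∈ A.winning, ∀ k, ∃ n, (pre s n).filterMap f = pre t k) ∨
  (∃ l ∈ A.finWinning, ∃ N, ∀ n ≥ N, (pre s n).filterMap f = l)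

/-- The part of a sequence that lies in the left component. -/
def lft {α β : Type*} (s : List (α ⊕ β)) : List α := s.filterMap Sum.getLeft?

/-- The part of a sequence that lies in the right component. -/
def rgt {α β : Type*} (s : List (α ⊕ β)) : List β := s.filterMap Sum.getRight?

section Parts

variable {α β : Type*}

@[simp] theorem lft_nil : lft ([] : List (α ⊕ β)) = [] := rfl
@[simp] theorem rgt_nil : rgt ([] : List (α ⊕ β)) = [] := rfl
@[simp] theorem lft_append (s t : List (α ⊕ β)) : lft (s ++ t) = lft s ++ lft t := by
  simp [lft]
@[simp] theorem rgt_append (s t : List (α ⊕ β)) : rgt (s ++ t) = rgt s ++ rgt t := by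
  simp [rgt]
@[simp] theorem lft_cons_inl (a : α) (s : List (α ⊕ β)) : lft (.inl a :: s) = a :: lft s := rfl
@[simp] theorem lft_cons_inr (b : β) (s : List (α ⊕ β)) : lft (.inr b :: s) = lft s := rfl
@[simp] theorem rgt_cons_inl (a : α) (s : List (α ⊕ β)) : rgt (.inl a :: s) = rgt s := rfl
@[simp] theorem rgt_cons_inr (b : β) (s : List (α ⊕ β)) : rgt (.inr b :: s) = b :: rgt s := rfl

end Parts

/-- The labelling of the moves of `A ⊸ B`: the roles of the players are exchanged in `A`. -/
def lolliLam (A B : NegGame.{u}) : A.Move ⊕ B.Move → Player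
  | .inl a => (A.lam a).swap
  | .inr b => B.lam b

/-- The plays of `A ⊸ B`: the alternating interleavings of plays of `A` and of `B`. (As Opponent
makes the first move of `A ⊸ B`, this move is in `B`.) -/
def lolliPlays (A B : NegGame.{u}) : Set (List (A.Move ⊕ B.Move)) :=
  {s | Alternating (lolliLam A B) s ∧ lft s ∈ A.plays ∧ rgt s ∈ B.plays}

theorem pre_succ {α : Type*} (s : ℕ → α) (n : ℕ) : pre s (n + 1) = pre s n ++ [s n] := by
  simp [pre, List.range_succ]

theorem pre_length {α : Type*} (s : ℕ → α) (n : ℕ) : (pre s n).length = n := by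
  simp [pre]

theorem turn_even {n : ℕ} (h : Even n) : turn n = .O := by simp [turn, h]

theorem turn_odd {n : ℕ} (h : ¬ Even n) : turn n = .P := by simp [turn, h]

theorem alternating_append {M : Type*} {lam : M → Player} {s t : List M}
    (h : Alternating lam (s ++ t)) : Alternating lam s := by
  intro k hk
  have := h k (by simp; omega)
  rwa [List.getElem_append_left hk] at this

theorem alternating_snoc {M : Type*} {lam : M → Player} {s : List M} {m : M} :
    Alternating lam (s ++ [m]) ↔ Alternating lam s ∧ lam m = turn s.length := by
  constructor
  · intro h
    refine ⟨alternating_append h, ?_⟩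
    have := h s.length (by simp)
    simpa using this
  · rintro ⟨h1, h2⟩ k hk
    by_cases hk' : k < s.length
    · rw [List.getElem_append_left hk']; exact h1 k hk'
    · have : k = s.length := by simp at hk; omega
      subst this
      simpa using h2

theorem NegGame.nil_mem (A : NegGame.{u}) : [] ∈ A.plays := by
  obtain ⟨s, hs⟩ := A.plays_nonempty
  exact A.plays_prefix [] s (by simpa using hs)

/-- The game `A ⊸ B`. An infinite play is won by Player if its restriction to `B` is won by Player
in `B` or its restriction to `A` is not won by Player in `A`. -/
def lolli (A B : NegGame.{u}) : NegGame.{u} where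
  Move := A.Move ⊕ B.Move
  lam := lolliLam A B
  plays := lolliPlays A B
  plays_nonempty := ⟨[], fun k hk => absurd hk (by simp), A.nil_mem, B.nil_mem⟩
  plays_prefix := by
    rintro s t ⟨h1, h2, h3⟩
    rw [lft_append] at h2
    rw [rgt_append] at h3
    exact ⟨alternating_append h1, A.plays_prefix _ _ h2, B.plays_prefix _ _ h3⟩
  plays_alternating := fun s hs => hs.1
  winning := {s | (∀ n, pre s n ∈ lolliPlays A B) ∧
    (B.WinsOn Sum.getRight? s ∨ ¬ A.WinsOn Sum.getLeft? s)}
  winning_plays := fun s hs => hs.1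

/-! ### Composition of strategies -/

/-- The disjoint union of three sets of moves. -/
inductive Tri (α β γ : Type u) : Type u
  | fst (a : α)
  | snd (b : β)
  | thd (c : γ)

namespace Tri

variable {α β γ : Type u}

/-- Restriction to the components one and two. -/
def r12 : Tri α β γ → Option (α ⊕ β)
  | fst a => some (.inl a)
  | snd b => some (.inr b)
  | thd _ => none

/-- Restriction to the components two and three. -/
def r23 : Tri α β γ → Option (β ⊕ γ)
  | fst _ => none
  | snd b => some (.inl b)
  | thd c => some (.inr c)

/-- Restriction to the components one and three. -/
def r13 : Tri α β γ → Option (α ⊕ γ)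
  | fst a => some (.inl a)
  | snd _ => none
  | thd c => some (.inr c)

/-- Restriction to the first component. -/
def r1 : Tri α β γ → Option α
  | fst a => some a
  | _ => none

/-- Restriction to the second component. -/
def r2 : Tri α β γ → Option β
  | snd b => some b
  | _ => none

/-- Restriction to the third component. -/
def r3 : Tri α β γ → Option γ
  | thd c => some c
  | _ => none

@[simp] theorem r12_fst (a : α) : r12 (fst a : Tri α β γ) = some (.inl a) := rfl
@[simp] theorem r12_snd (b : β) : r12 (snd b : Tri α β γ) = some (.inr b) := rfl
@[simp] theorem r12_thd (c : γ) : r12 (thd c : Tri α β γ) = none := rfl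
@[simp] theorem r23_fst (a : α) : r23 (fst a : Tri α β γ) = none := rfl
@[simp] theorem r23_snd (b : β) : r23 (snd b : Tri α β γ) = some (.inl b) := rfl
@[simp] theorem r23_thd (c : γ) : r23 (thd c : Tri α β γ) = some (.inr c) := rfl
@[simp] theorem r13_fst (a : α) : r13 (fst a : Tri α β γ) = some (.inl a) := rfl
@[simp] theorem r13_snd (b : β) : r13 (snd b : Tri α β γ) = none := rfl
@[simp] theorem r13_thd (c : γ) : r13 (thd c : Tri α β γ) = some (.inr c) := rfl
@[simp] theorem r1_fst (a : α) : r1 (fst a : Tri α β γ) = some a := rfl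
@[simp] theorem r1_snd (b : β) : r1 (snd b : Tri α β γ) = none := rfl
@[simp] theorem r1_thd (c : γ) : r1 (thd c : Tri α β γ) = none := rfl
@[simp] theorem r2_fst (a : α) : r2 (fst a : Tri α β γ) = none := rfl
@[simp] theorem r2_snd (b : β) : r2 (snd b : Tri α β γ) = some b := rfl
@[simp] theorem r2_thd (c : γ) : r2 (thd c : Tri α β γ) = none := rfl
@[simp] theorem r3_fst (a : α) : r3 (fst a : Tri α β γ) = none := rfl
@[simp] theorem r3_snd (b : β) : r3 (snd b : Tri α β γ) = none := rfl
@[simp] theorem r3_thd (c : γ) : r3 (thd c : Tri α β γ) = some c := rfl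

theorem lft_r12 (u : List (Tri α β γ)) : lft (u.filterMap r12) = u.filterMap r1 := by
  rw [lft, List.filterMap_filterMap]; congr 1; funext x; cases x <;> rfl
theorem rgt_r12 (u : List (Tri α β γ)) : rgt (u.filterMap r12) = u.filterMap r2 := by
  rw [rgt, List.filterMap_filterMap]; congr 1; funext x; cases x <;> rfl
theorem lft_r23 (u : List (Tri α β γ)) : lft (u.filterMap r23) = u.filterMap r2 := by
  rw [lft, List.filterMap_filterMap]; congr 1; funext x; cases x <;> rfl
theorem rgt_r23 (u : List (Tri α β γ)) : rgt (u.filterMap r23) = u.filterMap r3 := by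
  rw [rgt, List.filterMap_filterMap]; congr 1; funext x; cases x <;> rfl
theorem lft_r13 (u : List (Tri α β γ)) : lft (u.filterMap r13) = u.filterMap r1 := by
  rw [lft, List.filterMap_filterMap]; congr 1; funext x; cases x <;> rfl
theorem rgt_r13 (u : List (Tri α β γ)) : rgt (u.filterMap r13) = u.filterMap r3 := by
  rw [rgt, List.filterMap_filterMap]; congr 1; funext x; cases x <;> rfl

end Tri

theorem length_lft_rgt {α β : Type*} (s : List (α ⊕ β)) :
    s.length = (lft s).length + (rgt s).length := by
  induction s with
  | nil => rfl
  | cons x s ih => cases x <;> simp [ih] <;> omega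

section Lolli

variable {A B C : NegGame.{u}}

theorem NegGame.lam_of_snoc {s : List A.Move} {m : A.Move} (h : s ++ [m] ∈ A.plays) :
    A.lam m = turn s.length := (alternating_snoc.1 (A.plays_alternating _ h)).2

theorem lolli_snoc_inl {s : List (A.Move ⊕ B.Move)} {a : A.Move} :
    s ++ [Sum.inl a] ∈ lolliPlays A B ↔
      s ∈ lolliPlays A B ∧ lft s ++ [a] ∈ A.plays ∧ Odd (rgt s).length := by
  have hl := length_lft_rgt s
  have key : lft s ++ [a] ∈ A.plays →
      ((A.lam a).swap = turn s.length ↔ Odd (rgt s).length) := by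
    intro h
    rw [A.lam_of_snoc h, hl]
    simp only [turn, Nat.even_add, ← Nat.not_even_iff_odd]
    by_cases h1 : Even (lft s).length <;> by_cases h2 : Even (rgt s).length <;>
      simp [h1, h2, Player.swap]
  simp only [lolliPlays, Set.mem_ofPred_eq, alternating_snoc, lolliLam, lft_append, rgt_append]
  simp only [lft_cons_inl, rgt_cons_inl, lft_nil, rgt_nil, List.append_nil]
  constructor
  · rintro ⟨⟨h1, h2⟩, h3, h4⟩
    exact ⟨⟨h1, A.plays_prefix _ _ h3, h4⟩, h3, (key h3).1 h2⟩
  · rintro ⟨⟨h1, h2, h3⟩, h4, h5⟩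
    exact ⟨⟨h1, (key h4).2 h5⟩, h4, h3⟩

theorem lolli_snoc_inr {s : List (A.Move ⊕ B.Move)} {b : B.Move} :
    s ++ [Sum.inr b] ∈ lolliPlays A B ↔
      s ∈ lolliPlays A B ∧ rgt s ++ [b] ∈ B.plays ∧ Even (lft s).length := by
  have hl := length_lft_rgt s
  have key : rgt s ++ [b] ∈ B.plays →
      (B.lam b = turn s.length ↔ Even (lft s).length) := by
    intro h
    rw [B.lam_of_snoc h, hl]
    simp only [turn, Nat.even_add]
    by_cases h1 : Even (lft s).length <;> by_cases h2 : Even (rgt s).length <;>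
      simp [h1, h2]
  simp only [lolliPlays, Set.mem_ofPred_eq, alternating_snoc, lolliLam, lft_append, rgt_append]
  simp only [lft_cons_inr, rgt_cons_inr, lft_nil, rgt_nil, List.append_nil]
  constructor
  · rintro ⟨⟨h1, h2⟩, h3, h4⟩
    exact ⟨⟨h1, h3, B.plays_prefix _ _ h4⟩, h4, (key h4).1 h2⟩
  · rintro ⟨⟨h1, h2, h3⟩, h4, h5⟩
    exact ⟨⟨h1, (key h4).2 h5⟩, h2, h4⟩

theorem lolli_prefix {s t : List (A.Move ⊕ B.Move)} (h : s ++ t ∈ lolliPlays A B) :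
    s ∈ lolliPlays A B := (lolli A B).plays_prefix s t h

/-- The component `A` of a play of `A ⊸ B` is only waiting for Player to answer when so is `B`. -/
theorem lolli_parity {s : List (A.Move ⊕ B.Move)} (h : s ∈ lolliPlays A B) :
    Odd (lft s).length → Odd (rgt s).length := by
  induction s using List.reverseRecOn with
  | nil => simp
  | append_singleton s m ih =>
    cases m with
    | inl a =>
      obtain ⟨_, _, h3⟩ := lolli_snoc_inl.1 h
      intro _
      simpa using h3
    | inr b =>
      obtain ⟨h1, _, h3⟩ := lolli_snoc_inr.1 h
      intro h4
      simp at h4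
      exact absurd h3 (Nat.not_even_iff_odd.2 h4)

theorem Strategy.even_length (σ : Strategy A) {s : List A.Move} (h : s ∈ σ.carrier) :
    Even s.length := by
  induction s using List.reverseRecOn with
  | nil => simp
  | append_singleton s m _ =>
    have h1 := σ.last_player _ _ h
    have h2 := A.lam_of_snoc (σ.subset_plays _ h)
    by_contra h3
    have : Even s.length := by
      simpa [Nat.even_add_one] using h3
    rw [turn_even this, h1] at h2
    cases h2

theorem Strategy.even_prefix (σ : Strategy A) {s t : List A.Move} (h : s ++ t ∈ σ.carrier)
    (hs : Even s.length) : s ∈ σ.carrier := by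
  have ht : Even t.length := by
    have := σ.even_length h
    rw [List.length_append, Nat.even_add] at this
    exact this.1 hs
  obtain ⟨n, hn⟩ := ht
  induction n generalizing t with
  | zero => have : t = [] := by simpa using hn
            subst this; simpa using h
  | succ n ih =>
    obtain ⟨t', b, rfl⟩ : ∃ t' b, t = t' ++ [b] := by
      rcases List.eq_nil_or_concat t with rfl | ⟨t', b, rfl⟩
      · simp at hn
      · exact ⟨t', b, by simp⟩
    obtain ⟨t'', a, rfl⟩ : ∃ t'' a, t' = t'' ++ [a] := by
      rcases List.eq_nil_or_concat t' with rfl | ⟨t'', a, rfl⟩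
      · simp at hn; omega
      · exact ⟨t'', a, by simp⟩
    refine ih (t := t'') ?_ (by simp at hn; omega)
    apply σ.prefix_closed (s ++ t'') a b
    simpa using h

theorem Strategy.nil_mem (σ : Strategy A) : [] ∈ σ.carrier := by
  obtain ⟨s, hs⟩ := σ.nonempty
  exact σ.even_prefix (s := []) (t := s) (by simpa using hs) (by simp)

end Lolli

section Interaction

variable {A B C D : NegGame.{u}}

/-- Sequences in three components whose restrictions are plays of `A ⊸ B` and of `B ⊸ C`. -/
def Inter (A B C : NegGame.{u}) (u : List (Tri A.Move B.Move C.Move)) : Prop :=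
  u.filterMap Tri.r12 ∈ lolliPlays A B ∧ u.filterMap Tri.r23 ∈ lolliPlays B C

theorem length_r12 {α β γ : Type u} (u : List (Tri α β γ)) : (u.filterMap Tri.r12).length =
    (u.filterMap Tri.r1).length + (u.filterMap Tri.r2).length := by
  rw [length_lft_rgt, Tri.lft_r12, Tri.rgt_r12]

theorem length_r23 {α β γ : Type u} (u : List (Tri α β γ)) : (u.filterMap Tri.r23).length =
    (u.filterMap Tri.r2).length + (u.filterMap Tri.r3).length := by
  rw [length_lft_rgt, Tri.lft_r23, Tri.rgt_r23]

theorem length_r13 {α β γ : Type u} (u : List (Tri α β γ)) : (u.filterMap Tri.r13).length =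
    (u.filterMap Tri.r1).length + (u.filterMap Tri.r3).length := by
  rw [length_lft_rgt, Tri.lft_r13, Tri.rgt_r13]

theorem r12_inj {α β γ : Type u} {m n : Tri α β γ} {z : α ⊕ β} (h : m.r12 = some z)
    (h' : n.r12 = some z) : m = n := by
  cases m <;> cases n <;> cases z <;> simp_all [Tri.r12]

theorem r23_inj {α β γ : Type u} {m n : Tri α β γ} {z : β ⊕ γ} (h : m.r23 = some z)
    (h' : n.r23 = some z) : m = n := by
  cases m <;> cases n <;> cases z <;> simp_all [Tri.r23]

theorem inter_nil : Inter A B C [] := ⟨(lolli A B).nil_mem, (lolli B C).nil_mem⟩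

theorem Inter.pfx {u t : List (Tri A.Move B.Move C.Move)} (h : Inter A B C (u ++ t)) :
    Inter A B C u := by
  obtain ⟨h1, h2⟩ := h
  rw [List.filterMap_append] at h1 h2
  exact ⟨lolli_prefix h1, lolli_prefix h2⟩

theorem inter_snoc_fst {u : List (Tri A.Move B.Move C.Move)} {a : A.Move} :
    Inter A B C (u ++ [.fst a]) ↔ Inter A B C u ∧ u.filterMap Tri.r1 ++ [a] ∈ A.plays ∧
      Odd (u.filterMap Tri.r2).length := by
  simp only [Inter, List.filterMap_append]
  simp only [List.filterMap_cons, Tri.r12_fst, Tri.r23_fst, List.filterMap_nil, List.append_nil,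
    lolli_snoc_inl, Tri.lft_r12, Tri.rgt_r12]
  tauto

theorem inter_snoc_snd {u : List (Tri A.Move B.Move C.Move)} {b : B.Move} :
    Inter A B C (u ++ [.snd b]) ↔ Inter A B C u ∧ u.filterMap Tri.r2 ++ [b] ∈ B.plays ∧
      Even (u.filterMap Tri.r1).length ∧ Odd (u.filterMap Tri.r3).length := by
  simp only [Inter, List.filterMap_append]
  simp only [List.filterMap_cons, Tri.r12_snd, Tri.r23_snd, List.filterMap_nil,
    lolli_snoc_inl, lolli_snoc_inr, Tri.lft_r12, Tri.rgt_r12, Tri.lft_r23, Tri.rgt_r23]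
  tauto

theorem inter_snoc_thd {u : List (Tri A.Move B.Move C.Move)} {c : C.Move} :
    Inter A B C (u ++ [.thd c]) ↔ Inter A B C u ∧ u.filterMap Tri.r3 ++ [c] ∈ C.plays ∧
      Even (u.filterMap Tri.r2).length := by
  simp only [Inter, List.filterMap_append]
  simp only [List.filterMap_cons, Tri.r12_thd, Tri.r23_thd, List.filterMap_nil, List.append_nil,
    lolli_snoc_inr, Tri.lft_r23, Tri.rgt_r23]
  tauto

theorem Inter.parity12 {u : List (Tri A.Move B.Move C.Move)} (h : Inter A B C u) :
    Odd (u.filterMap Tri.r1).length → Odd (u.filterMap Tri.r2).length := by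
  have := lolli_parity h.1
  rwa [Tri.lft_r12, Tri.rgt_r12] at this

theorem Inter.parity23 {u : List (Tri A.Move B.Move C.Move)} (h : Inter A B C u) :
    Odd (u.filterMap Tri.r2).length → Odd (u.filterMap Tri.r3).length := by
  have := lolli_parity h.2
  rwa [Tri.lft_r23, Tri.rgt_r23] at this

theorem Inter.mem13 {u : List (Tri A.Move B.Move C.Move)} (h : Inter A B C u) :
    u.filterMap Tri.r13 ∈ lolliPlays A C := by
  induction u using List.reverseRecOn with
  | nil => exact (lolli A C).nil_mem
  | append_singleton u m ih =>
    have hu := ih h.pfx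
    rw [List.filterMap_append]
    cases m with
    | fst a =>
      obtain ⟨h1, h2, h3⟩ := inter_snoc_fst.1 h
      simp only [List.filterMap_cons, Tri.r13_fst, List.filterMap_nil]
      rw [lolli_snoc_inl, Tri.lft_r13, Tri.rgt_r13]
      exact ⟨hu, h2, h1.parity23 h3⟩
    | snd b => simpa only [List.filterMap_cons, Tri.r13_snd, List.filterMap_nil, List.append_nil] using hu
    | thd c =>
      obtain ⟨h1, h2, h3⟩ := inter_snoc_thd.1 h
      simp only [List.filterMap_cons, Tri.r13_thd, List.filterMap_nil]
      rw [lolli_snoc_inr, Tri.lft_r13, Tri.rgt_r13]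
      refine ⟨hu, h2, ?_⟩
      by_contra h4
      exact (Nat.not_even_iff_odd.2 (h1.parity12 (Nat.not_even_iff_odd.1 h4))) h3

/-- Interactions all of whose restrictions of even length belong to the given strategies. -/
def Compat (σ : Strategy (lolli A B)) (τ : Strategy (lolli B C))
    (u : List (Tri A.Move B.Move C.Move)) : Prop :=
  Inter A B C u ∧ ∀ p t, u = p ++ t →
    (Even (p.filterMap Tri.r12).length → p.filterMap Tri.r12 ∈ σ.carrier) ∧
    (Even (p.filterMap Tri.r23).length → p.filterMap Tri.r23 ∈ τ.carrier)

variable {σ : Strategy (lolli A B)} {τ : Strategy (lolli B C)}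

theorem compat_of_mem {u : List (Tri A.Move B.Move C.Move)}
    (h1 : u.filterMap Tri.r12 ∈ σ.carrier) (h2 : u.filterMap Tri.r23 ∈ τ.carrier) :
    Compat σ τ u := by
  refine ⟨⟨σ.subset_plays _ h1, τ.subset_plays _ h2⟩, ?_⟩
  rintro p t rfl
  rw [List.filterMap_append] at h1 h2
  exact ⟨fun h => σ.even_prefix h1 h, fun h => τ.even_prefix h2 h⟩

theorem Compat.pfx {u t : List (Tri A.Move B.Move C.Move)} (h : Compat σ τ (u ++ t)) :
    Compat σ τ u :=
  ⟨h.1.pfx, fun p t' e => h.2 p (t' ++ t) (by rw [e, List.append_assoc])⟩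

theorem Compat.mem12 {u : List (Tri A.Move B.Move C.Move)} (h : Compat σ τ u)
    (he : Even (u.filterMap Tri.r12).length) : u.filterMap Tri.r12 ∈ σ.carrier :=
  (h.2 u [] (by simp)).1 he

theorem Compat.mem23 {u : List (Tri A.Move B.Move C.Move)} (h : Compat σ τ u)
    (he : Even (u.filterMap Tri.r23).length) : u.filterMap Tri.r23 ∈ τ.carrier :=
  (h.2 u [] (by simp)).2 he

theorem compat_snoc {u : List (Tri A.Move B.Move C.Move)} {m : Tri A.Move B.Move C.Move}
    (h : Compat σ τ u) (hi : Inter A B C (u ++ [m]))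
    (h1 : Even ((u ++ [m]).filterMap Tri.r12).length → (u ++ [m]).filterMap Tri.r12 ∈ σ.carrier)
    (h2 : Even ((u ++ [m]).filterMap Tri.r23).length → (u ++ [m]).filterMap Tri.r23 ∈ τ.carrier) :
    Compat σ τ (u ++ [m]) := by
  refine ⟨hi, fun p t e => ?_⟩
  rcases List.eq_nil_or_concat t with rfl | ⟨t', b, rfl⟩
  · simp only [List.append_nil] at e
    subst e
    exact ⟨h1, h2⟩
  · rw [List.concat_eq_append, ← List.append_assoc] at e
    exact h.2 p t' (List.append_inj' e rfl).1

/-- When Opponent is to move in `A ⊸ C`, he is to move in `A ⊸ B` and in `B ⊸ C`. -/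
theorem Inter.even_of_even {u : List (Tri A.Move B.Move C.Move)} (h : Inter A B C u)
    (he : Even (u.filterMap Tri.r13).length) :
    Even (u.filterMap Tri.r12).length ∧ Even (u.filterMap Tri.r23).length := by
  have h1 := h.parity12
  have h2 := h.parity23
  rw [length_r13] at he
  rw [length_r12, length_r23]
  simp only [Nat.even_iff, Nat.odd_iff] at *
  omega

theorem Inter.odd_cases {u : List (Tri A.Move B.Move C.Move)} (h : Inter A B C u)
    (he : ¬ Even (u.filterMap Tri.r13).length) :
    (¬ Even (u.filterMap Tri.r12).length ∧ Even (u.filterMap Tri.r23).length) ∨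
    (Even (u.filterMap Tri.r12).length ∧ ¬ Even (u.filterMap Tri.r23).length) := by
  have h1 := h.parity12
  have h2 := h.parity23
  rw [length_r13] at he
  rw [length_r12, length_r23]
  simp only [Nat.even_iff, Nat.odd_iff] at *
  omega

/-- Opponent's moves in `A ⊸ C` are external. -/
theorem Inter.external {u : List (Tri A.Move B.Move C.Move)} {m : Tri A.Move B.Move C.Move}
    (h : Inter A B C (u ++ [m])) (he : Even (u.filterMap Tri.r13).length) :
    (∃ a, m = .fst a) ∨ ∃ c, m = .thd c := by
  cases m with
  | fst a => exact .inl ⟨a, rfl⟩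
  | thd c => exact .inr ⟨c, rfl⟩
  | snd b =>
    obtain ⟨h1, _, h3, h4⟩ := inter_snoc_snd.1 h
    rw [length_r13] at he
    simp only [Nat.even_iff, Nat.odd_iff] at *
    omega

theorem Compat.deterministic {u v : List (Tri A.Move B.Move C.Move)}
    (hu : Compat σ τ u) (hv : Compat σ τ v)
    (t x y) (hut : u.filterMap Tri.r13 = t ++ [x]) (hvt : v.filterMap Tri.r13 = t ++ [y])
    (ht : ¬ Even t.length) : ∀ p s, u = p ++ s → ∃ s', v = p ++ s' := by
  intro p
  induction p using List.reverseRecOn with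
  | nil => intro s _; exact ⟨v, rfl⟩
  | append_singleton p m ih =>
    intro s hs
    obtain ⟨s', rfl⟩ := ih (m :: s) (by simpa using hs)
    have hu1 : Compat σ τ (p ++ [m]) := Compat.pfx (t := s) (hs ▸ hu)
    have hut' : p.filterMap Tri.r13 ++ ([m] ++ s).filterMap Tri.r13 = t ++ [x] := by
      rw [← List.filterMap_append, ← hut, hs]; simp
    rcases s' with _ | ⟨m', s'⟩
    · exfalso
      rw [List.append_nil] at hvt
      have he : Even (p.filterMap Tri.r13).length := by
        rw [hvt]; simpa [Nat.even_add_one] using ht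
      have := congrArg List.length hut'
      rw [List.length_append, hvt] at this
      simp only [List.length_append, List.length_cons, List.length_nil] at this
      rcases hu1.1.external he with ⟨a, rfl⟩ | ⟨c, rfl⟩
      · simp at this
      · simp at this
    · have hv1 : Compat σ τ (p ++ [m']) := Compat.pfx (t := s') (by simpa using hv)
      suffices m = m' by subst this; exact ⟨s', by simp⟩
      have hvt' : p.filterMap Tri.r13 ++ ([m'] ++ s').filterMap Tri.r13 = t ++ [y] := by
        rw [← List.filterMap_append, ← hvt]; simp
      by_cases he : Even (p.filterMap Tri.r13).length
      · have key : ∀ (z z' : A.Move ⊕ C.Move) (l l' : List (A.Move ⊕ C.Move)),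
            p.filterMap Tri.r13 ++ z :: l = t ++ [x] → p.filterMap Tri.r13 ++ z' :: l' = t ++ [y] →
            z = z' := by
          intro z z' l l' h1 h2
          have hlen : (p.filterMap Tri.r13).length < t.length := by
            have := congrArg List.length h1
            simp only [List.length_append, List.length_cons, List.length_nil] at this
            by_contra hh
            have : (p.filterMap Tri.r13).length = t.length := by omega
            rw [this] at he
            exact ht he
          have e1 := congrArg (fun l => l[(p.filterMap Tri.r13).length]?) h1
          have e2 := congrArg (fun l => l[(p.filterMap Tri.r13).length]?) h2
          simp only [List.getElem?_append_left hlen] at e1 e2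
          rw [← e2] at e1
          simpa using e1
        rcases hu1.1.external he with ⟨a, rfl⟩ | ⟨c, rfl⟩ <;>
        rcases hv1.1.external he with ⟨a', rfl⟩ | ⟨c', rfl⟩ <;>
        simpa using key _ _ _ _ hut' hvt'
      · rcases hu1.1.pfx.odd_cases he with ⟨h1, h2⟩ | ⟨h1, h2⟩
        · -- the first strategy is to move
          have key : ∀ n : Tri A.Move B.Move C.Move, Compat σ τ (p ++ [n]) →
              ∃ z, Tri.r12 n = some z ∧ p.filterMap Tri.r12 ++ [z] ∈ σ.carrier := by
            intro n hn
            have h3 : ∃ z, Tri.r12 n = some z := by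
              cases n with
              | fst a => exact ⟨_, rfl⟩
              | snd b => exact ⟨_, rfl⟩
              | thd c =>
                obtain ⟨hi, _, h4⟩ := inter_snoc_thd.1 hn.1
                have := hi.parity12
                rw [length_r12] at h1
                simp only [Nat.even_iff, Nat.odd_iff] at *
                omega
            obtain ⟨z, hz⟩ := h3
            have h4 := hn.mem12
            simp only [List.filterMap_append, List.filterMap_cons, hz, List.filterMap_nil,
              List.length_append, List.length_cons, List.length_nil] at h4
            exact ⟨z, hz, h4 (by simpa [Nat.even_add_one] using h1)⟩
          obtain ⟨z, hz, hz'⟩ := key m hu1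
          obtain ⟨y, hy, hy'⟩ := key m' hv1
          have := σ.deterministic _ _ _ hz' hy'
          subst this
          exact r12_inj hz hy
        · have key : ∀ n : Tri A.Move B.Move C.Move, Compat σ τ (p ++ [n]) →
              ∃ z, Tri.r23 n = some z ∧ p.filterMap Tri.r23 ++ [z] ∈ τ.carrier := by
            intro n hn
            have h3 : ∃ z, Tri.r23 n = some z := by
              cases n with
              | snd b => exact ⟨_, rfl⟩
              | thd c => exact ⟨_, rfl⟩
              | fst a =>
                obtain ⟨hi, _, h4⟩ := inter_snoc_fst.1 hn.1
                have := hi.parity23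
                rw [length_r23] at h2
                simp only [Nat.even_iff, Nat.odd_iff] at *
                omega
            obtain ⟨z, hz⟩ := h3
            have h4 := hn.mem23
            simp only [List.filterMap_append, List.filterMap_cons, hz, List.filterMap_nil,
              List.length_append, List.length_cons, List.length_nil] at h4
            exact ⟨z, hz, h4 (by simpa [Nat.even_add_one] using h2)⟩
          obtain ⟨z, hz, hz'⟩ := key m hu1
          obtain ⟨y, hy, hy'⟩ := key m' hv1
          have := τ.deterministic _ _ _ hz' hy'
          subst this
          exact r23_inj hz hy

/-- If the visible part of `u` is `t ++ x :: l`, then `u` has a prefix with visible part `t` that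
is followed by the move `x`. -/
theorem exists_split {α β γ : Type u} {u : List (Tri α β γ)} {t l : List (α ⊕ γ)} {x : α ⊕ γ}
    (h : u.filterMap Tri.r13 = t ++ x :: l) :
    ∃ p m s, u = p ++ m :: s ∧ p.filterMap Tri.r13 = t ∧ Tri.r13 m = some x := by
  obtain ⟨p, s, rfl, h1, h2⟩ := List.filterMap_eq_append_iff.1 h
  obtain ⟨q, m, s', rfl, h3, h4, _⟩ := List.filterMap_eq_cons_iff.1 h2
  refine ⟨p ++ q, m, s', by simp, ?_, h4⟩
  rw [List.filterMap_append, h1, List.filterMap_eq_nil_iff.2 h3, List.append_nil]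

theorem even_r13 {u : List (Tri A.Move B.Move C.Move)}
    (h1 : u.filterMap Tri.r12 ∈ σ.carrier) (h2 : u.filterMap Tri.r23 ∈ τ.carrier) :
    Even (u.filterMap Tri.r13).length := by
  have e1 : Even (u.filterMap Tri.r12).length := σ.even_length h1
  have e2 : Even (u.filterMap Tri.r23).length := τ.even_length h2
  rw [length_r12] at e1
  rw [length_r23] at e2
  rw [length_r13]
  simp only [Nat.even_iff] at *
  omega

/-- Composition of strategies: parallel composition and hiding. -/
def compStrategy (σ : Strategy (lolli A B)) (τ : Strategy (lolli B C)) :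
    Strategy (lolli A C) where
  carrier := {s | ∃ u : List (Tri A.Move B.Move C.Move),
    u.filterMap Tri.r12 ∈ σ.carrier ∧ u.filterMap Tri.r23 ∈ τ.carrier ∧ u.filterMap Tri.r13 = s}
  subset_plays := by
    rintro s ⟨u, h1, h2, rfl⟩
    exact (compat_of_mem h1 h2).1.mem13
  last_player := by
    rintro (s : List (A.Move ⊕ C.Move)) (a : A.Move ⊕ C.Move) ⟨u, h1, h2, h3⟩
    replace h3 : u.filterMap Tri.r13 = s ++ [a] := h3
    have hs : s ++ [a] ∈ lolliPlays A C := h3 ▸ (compat_of_mem h1 h2).1.mem13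
    have hl := (lolli A C).lam_of_snoc (s := s) (m := a) hs
    rw [hl]
    apply turn_odd
    change ¬ Even (List.length (α := A.Move ⊕ C.Move) s)
    have := even_r13 h1 h2
    rw [h3] at this
    simpa [Nat.even_add_one] using this
  prefix_closed := by
    rintro (s : List (A.Move ⊕ C.Move)) (a : A.Move ⊕ C.Move) (b : A.Move ⊕ C.Move) ⟨u, h1, h2, h3⟩
    replace h3 : u.filterMap Tri.r13 = s ++ [a, b] := h3
    have hs := even_r13 h1 h2
    rw [h3] at hs
    replace hs : Even s.length := by simpa [Nat.even_add] using hs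
    obtain ⟨p, m, t, rfl, h4, h5⟩ := exists_split h3
    have hc := compat_of_mem h1 h2
    have he := hc.1.pfx.even_of_even (h4 ▸ hs)
    exact ⟨p, hc.pfx.mem12 he.1, hc.pfx.mem23 he.2, h4⟩
  deterministic := by
    rintro (s : List (A.Move ⊕ C.Move)) (a : A.Move ⊕ C.Move) (b : A.Move ⊕ C.Move)
      ⟨u, h1, h2, h3⟩ ⟨v, h4, h5, h6⟩
    replace h3 : u.filterMap Tri.r13 = s ++ [a] := h3
    replace h6 : v.filterMap Tri.r13 = s ++ [b] := h6
    have hs := even_r13 h1 h2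
    rw [h3] at hs
    replace hs : ¬ Even s.length := by simpa [Nat.even_add_one] using hs
    have hu := compat_of_mem h1 h2
    have hv := compat_of_mem h4 h5
    obtain ⟨s', rfl⟩ := hu.deterministic hv _ _ _ h3 h6 hs u [] (by simp)
    rw [List.filterMap_append, h3, List.append_assoc] at h6
    have := List.append_cancel_left h6
    simp at this
    exact this.1
  nonempty := ⟨[], [], σ.nil_mem, τ.nil_mem, rfl⟩

theorem compStrategy_mono {σ σ' : Strategy (lolli A B)} {τ τ' : Strategy (lolli B C)}
    (h1 : σ ≤ σ') (h2 : τ ≤ τ') : compStrategy σ τ ≤ compStrategy σ' τ' := by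
  rintro s ⟨u, h3, h4, h5⟩
  exact ⟨u, h1 h3, h2 h4, h5⟩

theorem exists_merge {α β γ δ : Type u} (n : ℕ) (x : List (Tri α β γ)) (y : List (Tri α γ δ))
    (hn : x.length + y.length ≤ n)
    (h : x.filterMap Tri.r13 = y.filterMap Tri.r12) :
    ∃ (z : List (Tri α β δ)) (z' : List (Tri β γ δ)),
      z.filterMap Tri.r12 = x.filterMap Tri.r12 ∧ z'.filterMap Tri.r12 = x.filterMap Tri.r23 ∧
      z'.filterMap Tri.r23 = y.filterMap Tri.r23 ∧ z.filterMap Tri.r23 = z'.filterMap Tri.r13 ∧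
      z.filterMap Tri.r13 = y.filterMap Tri.r13 := by
  induction n generalizing x y with
  | zero =>
    obtain ⟨rfl, rfl⟩ : x = [] ∧ y = [] := by
      constructor <;> apply List.eq_nil_of_length_eq_zero <;> omega
    exact ⟨[], [], rfl, rfl, rfl, rfl, rfl⟩
  | succ n ih =>
    rcases x with _ | ⟨a, x⟩
    · rcases y with _ | ⟨b, y⟩
      · exact ⟨[], [], rfl, rfl, rfl, rfl, rfl⟩
      · cases b with
        | fst b => simp at h
        | snd b => simp at h
        | thd b =>
          obtain ⟨z, z', h1, h2, h3, h4, h5⟩ := ih [] y (by simp at hn ⊢; omega) (by simpa using h)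
          exact ⟨.thd b :: z, .thd b :: z', by simpa [List.filterMap_cons] using h1, by simpa [List.filterMap_cons] using h2,
            by simpa [List.filterMap_cons] using h3, by simpa [List.filterMap_cons] using h4, by simpa [List.filterMap_cons] using h5⟩
    · cases a with
      | snd a =>
        obtain ⟨z, z', h1, h2, h3, h4, h5⟩ := ih x y (by simp at hn ⊢; omega) (by simpa [List.filterMap_cons] using h)
        exact ⟨.snd a :: z, .fst a :: z', by simpa [List.filterMap_cons] using h1, by simpa [List.filterMap_cons] using h2,
          by simpa [List.filterMap_cons] using h3, by simpa [List.filterMap_cons] using h4, by simpa [List.filterMap_cons] using h5⟩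
      | fst a =>
        rcases y with _ | ⟨b, y⟩
        · simp at h
        cases b with
        | fst b =>
          simp at h
          obtain ⟨rfl, h⟩ := h
          obtain ⟨z, z', h1, h2, h3, h4, h5⟩ := ih x y (by simp at hn ⊢; omega) h
          exact ⟨.fst a :: z, z', by simpa [List.filterMap_cons] using h1, by simpa [List.filterMap_cons] using h2,
            by simpa [List.filterMap_cons] using h3, by simpa [List.filterMap_cons] using h4, by simpa [List.filterMap_cons] using h5⟩
        | snd b => simp at h
        | thd b =>
          obtain ⟨z, z', h1, h2, h3, h4, h5⟩ := ih (.fst a :: x) y (by simp at hn ⊢; omega)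
            (by simpa [List.filterMap_cons] using h)
          exact ⟨.thd b :: z, .thd b :: z', by simpa [List.filterMap_cons] using h1, by simpa [List.filterMap_cons] using h2,
            by simpa [List.filterMap_cons] using h3, by simpa [List.filterMap_cons] using h4, by simpa [List.filterMap_cons] using h5⟩
      | thd a =>
        rcases y with _ | ⟨b, y⟩
        · simp at h
        cases b with
        | snd b =>
          simp at h
          obtain ⟨rfl, h⟩ := h
          obtain ⟨z, z', h1, h2, h3, h4, h5⟩ := ih x y (by simp at hn ⊢; omega) h
          exact ⟨z, .snd a :: z', by simpa [List.filterMap_cons] using h1, by simpa [List.filterMap_cons] using h2,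
            by simpa [List.filterMap_cons] using h3, by simpa [List.filterMap_cons] using h4, by simpa [List.filterMap_cons] using h5⟩
        | fst b => simp at h
        | thd b =>
          obtain ⟨z, z', h1, h2, h3, h4, h5⟩ := ih (.thd a :: x) y (by simp at hn ⊢; omega)
            (by simpa [List.filterMap_cons] using h)
          exact ⟨.thd b :: z, .thd b :: z', by simpa [List.filterMap_cons] using h1, by simpa [List.filterMap_cons] using h2,
            by simpa [List.filterMap_cons] using h3, by simpa [List.filterMap_cons] using h4, by simpa [List.filterMap_cons] using h5⟩

/-- Exchange of the outer components. -/
def Tri.rev {α β γ : Type u} : Tri α β γ → Tri γ β α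
  | .fst a => .thd a
  | .snd b => .snd b
  | .thd c => .fst c

theorem r12_rev {α β γ : Type u} (u : List (Tri α β γ)) :
    (u.map Tri.rev).filterMap Tri.r12 = (u.filterMap Tri.r23).map Sum.swap := by
  induction u with
  | nil => rfl
  | cons a u ih => cases a <;> simp [List.filterMap_cons, Tri.rev, ih]

theorem r23_rev {α β γ : Type u} (u : List (Tri α β γ)) :
    (u.map Tri.rev).filterMap Tri.r23 = (u.filterMap Tri.r12).map Sum.swap := by
  induction u with
  | nil => rfl
  | cons a u ih => cases a <;> simp [List.filterMap_cons, Tri.rev, ih]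

theorem r13_rev {α β γ : Type u} (u : List (Tri α β γ)) :
    (u.map Tri.rev).filterMap Tri.r13 = (u.filterMap Tri.r13).map Sum.swap := by
  induction u with
  | nil => rfl
  | cons a u ih => cases a <;> simp [List.filterMap_cons, Tri.rev, ih]

theorem map_swap_swap {α β : Type u} (u : List (α ⊕ β)) :
    (u.map Sum.swap).map Sum.swap = u := by simp

theorem compStrategy_assoc (σ : Strategy (lolli A B)) (τ : Strategy (lolli B C))
    (υ : Strategy (lolli C D)) :
    compStrategy (compStrategy σ τ) υ = compStrategy σ (compStrategy τ υ) := by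
  apply Strategy.ext
  ext s
  constructor
  · rintro ⟨y, ⟨x, h1, h2, h3⟩, h4, rfl⟩
    obtain ⟨z, z', e1, e2, e3, e4, e5⟩ := exists_merge _ x y le_rfl h3
    exact ⟨z, e1 ▸ h1, ⟨z', e2 ▸ h2, e3 ▸ h4, e4.symm⟩, e5⟩
  · rintro ⟨x, h1, ⟨y, h2, h3, h4⟩, rfl⟩
    obtain ⟨z, z', e1, e2, e3, e4, e5⟩ := exists_merge _ (y.map Tri.rev) (x.map Tri.rev) le_rfl
      (by rw [r13_rev, h4, r12_rev])
    have f1 := r23_rev z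
    have f2 := r12_rev z
    have f3 := r13_rev z
    have f4 := r23_rev z'
    have f5 := r12_rev z'
    have f6 := r13_rev z'
    rw [e1, r12_rev y, map_swap_swap] at f1
    rw [e5, r13_rev x, map_swap_swap] at f3
    rw [e2, r23_rev y, map_swap_swap] at f4
    rw [e3, r23_rev x, map_swap_swap] at f5
    rw [e4] at f2
    exact ⟨z.map Tri.rev, ⟨z'.map Tri.rev, f5 ▸ h1, f4 ▸ h2, f6.trans f2.symm⟩, f1 ▸ h3, f3⟩

end Interaction

/-! ### Copycat strategies -/

section Copycat

/-- A relabelling of the plays of `C` as plays of `B`, along which one can copy. -/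
structure CopyMap (B C : NegGame.{u}) (φ : C.Move → B.Move) : Prop where
  inj : Function.Injective φ
  plays : ∀ s : List C.Move, s.map φ ∈ B.plays ↔ s ∈ C.plays
  exists_of_snoc : ∀ (s : List C.Move) (b : B.Move), s ≠ [] → s.map φ ++ [b] ∈ B.plays →
    ∃ c, φ c = b
  winning : ∀ t : ℕ → C.Move, φ ∘ t ∈ B.winning → t ∈ C.winning

variable {A B C D : NegGame.{u}} {φ : C.Move → B.Move}

/-- The plays of even length of `B ⊸ C` in which Player copies the moves of Opponent from one
component to the other along `φ`. -/
def copycatSet (B C : NegGame.{u}) (φ : C.Move → B.Move) : Set (List (B.Move ⊕ C.Move)) :=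
  {s | s ∈ lolliPlays B C ∧ Even s.length ∧
    ∀ p t, s = p ++ t → Even p.length → lft p = (rgt p).map φ}

theorem copycatSet_eq {s : List (B.Move ⊕ C.Move)} (h : s ∈ copycatSet B C φ) :
    lft s = (rgt s).map φ := h.2.2 s [] (by simp) h.2.1

theorem copycatSet_pfx {s t : List (B.Move ⊕ C.Move)} (h : s ++ t ∈ copycatSet B C φ)
    (hs : Even s.length) : s ∈ copycatSet B C φ :=
  ⟨lolli_prefix h.1, hs, fun p t' e => h.2.2 p (t' ++ t) (by rw [e, List.append_assoc])⟩

theorem copycatSet_snoc {s : List (B.Move ⊕ C.Move)} {x y : B.Move ⊕ C.Move}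
    (h : s ∈ copycatSet B C φ) (h1 : s ++ [x] ++ [y] ∈ lolliPlays B C)
    (h2 : lft (s ++ [x] ++ [y]) = (rgt (s ++ [x] ++ [y])).map φ) :
    s ++ [x] ++ [y] ∈ copycatSet B C φ := by
  refine ⟨h1, by simpa [Nat.even_add] using h.2.1, fun p t e hp => ?_⟩
  rcases List.eq_nil_or_concat t with rfl | ⟨t', b, rfl⟩
  · rw [List.append_nil] at e
    exact e ▸ h2
  · rw [List.concat_eq_append, ← List.append_assoc] at e
    have e1 := (List.append_inj' e rfl).1
    rcases List.eq_nil_or_concat t' with rfl | ⟨t'', b', rfl⟩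
    · rw [List.append_nil] at e1
      subst e1
      exfalso
      have h3 := h.2.1
      rw [List.length_append, List.length_singleton] at hp
      simp only [Nat.even_iff] at *
      omega
    · rw [List.concat_eq_append, ← List.append_assoc] at e1
      exact h.2.2 p t'' (List.append_inj' e1 rfl).1 hp

theorem copycatSet_extend_even (hφ : CopyMap B C φ) {s : List (B.Move ⊕ C.Move)} {c : C.Move}
    (h : s ∈ copycatSet B C φ) (hc : rgt s ++ [c] ∈ C.plays) (he : Even (rgt s).length) :
    s ++ [.inr c] ++ [.inl (φ c)] ∈ copycatSet B C φ := by
  have e := copycatSet_eq h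
  apply copycatSet_snoc h
  · rw [lolli_snoc_inl, lolli_snoc_inr]
    refine ⟨⟨h.1, hc, by rw [e]; simpa using he⟩, ?_, ?_⟩
    · have := (hφ.plays _).2 hc
      simpa [e] using this
    · simpa [Nat.odd_add_one] using he
  · simp [e]

theorem copycatSet_extend_odd (hφ : CopyMap B C φ) {s : List (B.Move ⊕ C.Move)} {c : C.Move}
    (h : s ∈ copycatSet B C φ) (hc : rgt s ++ [c] ∈ C.plays) (he : ¬ Even (rgt s).length) :
    s ++ [.inl (φ c)] ++ [.inr c] ∈ copycatSet B C φ := by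
  have e := copycatSet_eq h
  apply copycatSet_snoc h
  · rw [lolli_snoc_inr, lolli_snoc_inl]
    refine ⟨⟨h.1, ?_, Nat.not_even_iff_odd.1 he⟩, by simpa using hc, ?_⟩
    · have := (hφ.plays _).2 hc
      simpa [e] using this
    · simp only [lft_append, lft_cons_inl, lft_nil, e, List.length_append, List.length_map,
        List.length_singleton, Nat.even_add_one]
      exact he
  · simp [e]

theorem nil_mem_copycatSet : [] ∈ copycatSet B C φ := by
  refine ⟨(lolli B C).nil_mem, by simp, fun p t e _ => ?_⟩
  have : p = [] := (List.append_eq_nil_iff.1 e.symm).1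
  subst this
  rfl

/-- The copycat strategy on `B ⊸ C` along a relabelling. -/
def copycat (φ : C.Move → B.Move) (hφ : CopyMap B C φ) : Strategy (lolli B C) where
  carrier := copycatSet B C φ
  subset_plays := fun s hs => hs.1
  last_player := by
    rintro (s : List (B.Move ⊕ C.Move)) (a : B.Move ⊕ C.Move) h
    rw [(lolli B C).lam_of_snoc (s := s) (m := a) h.1]
    apply turn_odd
    have h2 : Even (s ++ [a]).length := h.2.1
    change ¬ Even (List.length (α := B.Move ⊕ C.Move) s)
    simpa [Nat.even_add_one] using h2
  prefix_closed := by
    rintro (s : List (B.Move ⊕ C.Move)) (a : B.Move ⊕ C.Move) (b : B.Move ⊕ C.Move) h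
    have h2 : Even (s ++ [a, b]).length := h.2.1
    exact copycatSet_pfx h (by simpa [Nat.even_add] using h2)
  deterministic := by
    rintro (s : List (B.Move ⊕ C.Move)) (a : B.Move ⊕ C.Move) (b : B.Move ⊕ C.Move) h h'
    have e1 : lft (s ++ [a]) = (rgt (s ++ [a])).map φ := copycatSet_eq h
    have e2 : lft (s ++ [b]) = (rgt (s ++ [b])).map φ := copycatSet_eq h'
    rcases a with a | a <;> rcases b with b | b
    · simp at e1 e2
      rw [← e2] at e1
      have := List.append_cancel_left e1
      simp at this
      rw [this]
    · have l1 := congrArg List.length e1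
      have l2 := congrArg List.length e2
      simp at l1 l2
      omega
    · have l1 := congrArg List.length e1
      have l2 := congrArg List.length e2
      simp at l1 l2
      omega
    · simp at e1 e2
      rw [e2] at e1
      have := List.append_cancel_left e1
      simp at this
      rw [hφ.inj this]
  nonempty := ⟨[], nil_mem_copycatSet⟩

theorem eq_nil_or_snoc_snoc {α : Type*} (u : List α) :
    u = [] ∨ (∃ x, u = [x]) ∨ ∃ q x y, u = q ++ [x] ++ [y] := by
  rcases List.eq_nil_or_concat u with rfl | ⟨p, y, rfl⟩
  · exact .inl rfl
  · rcases List.eq_nil_or_concat p with rfl | ⟨q, x, rfl⟩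
    · exact .inr (.inl ⟨y, rfl⟩)
    · exact .inr (.inr ⟨q, x, y, by simp⟩)

theorem post_copycat_forward (n : ℕ) (u : List (Tri A.Move B.Move C.Move)) (hn : u.length ≤ n)
    (h1 : u.filterMap Tri.r12 ∈ lolliPlays A B) (h2 : u.filterMap Tri.r23 ∈ copycatSet B C φ) :
    u.filterMap Tri.r12 = (u.filterMap Tri.r13).map (Sum.map id φ) := by
  induction n generalizing u with
  | zero => have : u = [] := List.eq_nil_of_length_eq_zero (by omega)
            subst this; rfl
  | succ n ih =>
    have hi : Inter A B C u := ⟨h1, h2.1⟩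
    rcases List.eq_nil_or_concat u with rfl | ⟨p, m, rfl⟩
    · rfl
    rw [List.concat_eq_append] at *
    rw [List.length_append, List.length_singleton] at hn
    cases m with
    | fst a =>
      have hi' := (inter_snoc_fst.1 hi).1
      have := ih p (by omega) hi'.1 (by simpa [List.filterMap_cons] using h2)
      simp [List.filterMap_cons, this]
    | snd b =>
      obtain ⟨hi', _, h3, h4⟩ := inter_snoc_snd.1 hi
      have h5 := h2.2.1
      have h6 := copycatSet_eq h2
      rw [length_r23] at h5
      rw [Tri.lft_r23, Tri.rgt_r23] at h6
      rcases List.eq_nil_or_concat p with rfl | ⟨q, m', rfl⟩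
      · simp at h4
      rw [List.concat_eq_append] at *
      cases m' with
      | fst a =>
        obtain ⟨_, _, h7⟩ := inter_snoc_fst.1 hi'
        simp [List.filterMap_cons] at h3 h4 h5 h7
        simp only [Nat.even_iff, Nat.odd_iff] at *
        omega
      | snd b' =>
        simp [List.filterMap_cons] at h3 h4 h5 h6
        have h8 := h2.2.2 (q.filterMap Tri.r23) [.inl b', .inl b] (by simp [List.filterMap_cons])
          (by rw [length_r23]; simp only [Nat.even_iff, Nat.odd_iff] at *; omega)
        rw [Tri.lft_r23, Tri.rgt_r23] at h8
        rw [← h8] at h6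
        simp at h6
      | thd c =>
        simp [List.filterMap_cons] at h3 h4 h5 h6
        have h8 : q.filterMap Tri.r23 ∈ copycatSet B C φ := copycatSet_pfx (t := [.inr c, .inl b])
          (by simpa [List.filterMap_cons] using h2)
          (by rw [length_r23]; simp only [Nat.even_iff, Nat.odd_iff] at *; omega)
        have h9 := copycatSet_eq h8
        rw [Tri.lft_r23, Tri.rgt_r23] at h9
        rw [← h9] at h6
        simp at h6
        have := ih q (by simp at hn; omega) hi'.pfx.1 h8
        simp [List.filterMap_cons, this, h6]
    | thd c =>
      obtain ⟨hi', _, h3⟩ := inter_snoc_thd.1 hi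
      have h5 := h2.2.1
      have h6 := copycatSet_eq h2
      rw [length_r23] at h5
      rw [Tri.lft_r23, Tri.rgt_r23] at h6
      rcases List.eq_nil_or_concat p with rfl | ⟨q, m', rfl⟩
      · simp [List.filterMap_cons] at h5
      rw [List.concat_eq_append] at *
      cases m' with
      | fst a =>
        obtain ⟨_, _, h7⟩ := inter_snoc_fst.1 hi'
        simp [List.filterMap_cons] at h3 h5 h7
        simp only [Nat.even_iff, Nat.odd_iff] at *
        omega
      | thd c' =>
        simp [List.filterMap_cons] at h3 h5 h6
        have h8 := h2.2.2 (q.filterMap Tri.r23) [.inr c', .inr c] (by simp [List.filterMap_cons])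
          (by rw [length_r23]; simp only [Nat.even_iff, Nat.odd_iff] at *; omega)
        rw [Tri.lft_r23, Tri.rgt_r23] at h8
        rw [← h8] at h6
        simp at h6
      | snd b =>
        simp [List.filterMap_cons] at h3 h5 h6
        have h8 : q.filterMap Tri.r23 ∈ copycatSet B C φ := copycatSet_pfx (t := [.inl b, .inr c])
          (by simpa [List.filterMap_cons] using h2)
          (by rw [length_r23]; simp only [Nat.even_iff, Nat.odd_iff] at *; omega)
        have h9 := copycatSet_eq h8
        rw [Tri.lft_r23, Tri.rgt_r23] at h9
        rw [← h9] at h6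
        simp at h6
        have := ih q (by simp at hn; omega) hi'.pfx.1 h8
        simp [List.filterMap_cons, this, h6]

theorem pre_copycat_forward (n : ℕ) (u : List (Tri B.Move C.Move D.Move)) (hn : u.length ≤ n)
    (h1 : u.filterMap Tri.r23 ∈ lolliPlays C D) (h2 : u.filterMap Tri.r12 ∈ copycatSet B C φ) :
    u.filterMap Tri.r13 = (u.filterMap Tri.r23).map (Sum.map φ id) := by
  induction n generalizing u with
  | zero => have : u = [] := List.eq_nil_of_length_eq_zero (by omega)
            subst this; rfl
  | succ n ih =>
    have hi : Inter B C D u := ⟨h2.1, h1⟩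
    rcases List.eq_nil_or_concat u with rfl | ⟨p, m, rfl⟩
    · rfl
    rw [List.concat_eq_append] at *
    rw [List.length_append, List.length_singleton] at hn
    cases m with
    | thd d =>
      have hi' := (inter_snoc_thd.1 hi).1
      have := ih p (by omega) hi'.2 (by simpa [List.filterMap_cons] using h2)
      simp [List.filterMap_cons, this]
    | fst b =>
      obtain ⟨hi', _, h3⟩ := inter_snoc_fst.1 hi
      have h5 := h2.2.1
      have h6 := copycatSet_eq h2
      rw [length_r12] at h5
      rw [Tri.lft_r12, Tri.rgt_r12] at h6
      rcases List.eq_nil_or_concat p with rfl | ⟨q, m', rfl⟩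
      · simp at h3
      rw [List.concat_eq_append] at *
      cases m' with
      | thd d =>
        obtain ⟨_, _, h7⟩ := inter_snoc_thd.1 hi'
        simp [List.filterMap_cons] at h3 h5 h7
        simp only [Nat.even_iff, Nat.odd_iff] at *
        omega
      | fst b' =>
        simp [List.filterMap_cons] at h3 h5 h6
        have h8 := h2.2.2 (q.filterMap Tri.r12) [.inl b', .inl b] (by simp [List.filterMap_cons])
          (by rw [length_r12]; simp only [Nat.even_iff, Nat.odd_iff] at *; omega)
        rw [Tri.lft_r12, Tri.rgt_r12] at h8
        rw [← h8] at h6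
        simp at h6
      | snd c =>
        simp [List.filterMap_cons] at h3 h5 h6
        have h8 : q.filterMap Tri.r12 ∈ copycatSet B C φ := copycatSet_pfx (t := [.inr c, .inl b])
          (by simpa [List.filterMap_cons] using h2)
          (by rw [length_r12]; simp only [Nat.even_iff, Nat.odd_iff] at *; omega)
        have h9 := copycatSet_eq h8
        rw [Tri.lft_r12, Tri.rgt_r12] at h9
        rw [← h9] at h6
        simp at h6
        have := ih q (by simp at hn; omega) hi'.pfx.2 h8
        simp [List.filterMap_cons, this, h6]
    | snd c =>
      obtain ⟨hi', _, h3, h4⟩ := inter_snoc_snd.1 hi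
      have h5 := h2.2.1
      have h6 := copycatSet_eq h2
      rw [length_r12] at h5
      rw [Tri.lft_r12, Tri.rgt_r12] at h6
      rcases List.eq_nil_or_concat p with rfl | ⟨q, m', rfl⟩
      · simp at h4
      rw [List.concat_eq_append] at *
      cases m' with
      | thd d =>
        obtain ⟨_, _, h7⟩ := inter_snoc_thd.1 hi'
        simp [List.filterMap_cons] at h3 h4 h5 h7
        simp only [Nat.even_iff, Nat.odd_iff] at *
        omega
      | snd c' =>
        simp [List.filterMap_cons] at h3 h4 h5 h6
        have h8 := h2.2.2 (q.filterMap Tri.r12) [.inr c', .inr c] (by simp [List.filterMap_cons])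
          (by rw [length_r12]; simp only [Nat.even_iff, Nat.odd_iff] at *; omega)
        rw [Tri.lft_r12, Tri.rgt_r12] at h8
        rw [← h8] at h6
        simp at h6
      | fst b =>
        simp [List.filterMap_cons] at h3 h4 h5 h6
        have h8 : q.filterMap Tri.r12 ∈ copycatSet B C φ := copycatSet_pfx (t := [.inl b, .inr c])
          (by simpa [List.filterMap_cons] using h2)
          (by rw [length_r12]; simp only [Nat.even_iff, Nat.odd_iff] at *; omega)
        have h9 := copycatSet_eq h8
        rw [Tri.lft_r12, Tri.rgt_r12] at h9
        rw [← h9] at h6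
        simp at h6
        have := ih q (by simp at hn; omega) hi'.pfx.2 h8
        simp [List.filterMap_cons, this, h6]

theorem rgt_map {α β γ : Type*} (s : List (α ⊕ β)) (f : β → γ) :
    rgt (s.map (Sum.map id f)) = (rgt s).map f := by
  induction s with
  | nil => rfl
  | cons x s ih => cases x <;> simp [ih]

theorem lft_map {α β γ : Type*} (s : List (α ⊕ β)) (f : β → γ) :
    lft (s.map (Sum.map id f)) = lft s := by
  induction s with
  | nil => rfl
  | cons x s ih => cases x <;> simp [ih]

theorem post_copycat_backward (hφ : CopyMap B C φ) (t : List (A.Move ⊕ C.Move))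
    (ht : rgt t ∈ C.plays) :
    ∃ u : List (Tri A.Move B.Move C.Move), u.filterMap Tri.r13 = t ∧
      u.filterMap Tri.r12 = t.map (Sum.map id φ) ∧ u.filterMap Tri.r23 ∈ copycatSet B C φ := by
  induction t using List.reverseRecOn with
  | nil => exact ⟨[], rfl, rfl, (copycat φ hφ).nil_mem⟩
  | append_singleton t m ih =>
    cases m with
    | inl a =>
      obtain ⟨u, h1, h2, h3⟩ := ih (by simpa using ht)
      exact ⟨u ++ [.fst a], by simp [List.filterMap_cons, h1], by simp [List.filterMap_cons, h2],
        by simpa [List.filterMap_cons] using h3⟩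
    | inr c =>
      have hc : rgt t ++ [c] ∈ C.plays := by simpa using ht
      obtain ⟨u, h1, h2, h3⟩ := ih (C.plays_prefix _ _ hc)
      have h4 : rgt (u.filterMap Tri.r23) = rgt t := by
        rw [Tri.rgt_r23, ← Tri.rgt_r13, h1]
      by_cases he : Even (rgt t).length
      · have := copycatSet_extend_even hφ h3 (h4.symm ▸ hc) (h4.symm ▸ he)
        exact ⟨u ++ [.thd c, .snd (φ c)], by simp [List.filterMap_cons, h1],
          by simp [List.filterMap_cons, h2], by simpa [List.filterMap_cons] using this⟩
      · have := copycatSet_extend_odd hφ h3 (h4.symm ▸ hc) (h4.symm ▸ he)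
        exact ⟨u ++ [.snd (φ c), .thd c], by simp [List.filterMap_cons, h1],
          by simp [List.filterMap_cons, h2], by simpa [List.filterMap_cons] using this⟩

theorem pre_copycat_backward (hφ : CopyMap B C φ) (t : List (C.Move ⊕ D.Move))
    (ht : lft t ∈ C.plays) :
    ∃ u : List (Tri B.Move C.Move D.Move), u.filterMap Tri.r23 = t ∧
      u.filterMap Tri.r13 = t.map (Sum.map φ id) ∧ u.filterMap Tri.r12 ∈ copycatSet B C φ := by
  induction t using List.reverseRecOn with
  | nil => exact ⟨[], rfl, rfl, (copycat φ hφ).nil_mem⟩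
  | append_singleton t m ih =>
    cases m with
    | inr a =>
      obtain ⟨u, h1, h2, h3⟩ := ih (by simpa using ht)
      exact ⟨u ++ [.thd a], by simp [List.filterMap_cons, h1], by simp [List.filterMap_cons, h2],
        by simpa [List.filterMap_cons] using h3⟩
    | inl c =>
      have hc : lft t ++ [c] ∈ C.plays := by simpa using ht
      obtain ⟨u, h1, h2, h3⟩ := ih (C.plays_prefix _ _ hc)
      have h4 : rgt (u.filterMap Tri.r12) = lft t := by
        rw [Tri.rgt_r12, ← Tri.lft_r23, h1]
      by_cases he : Even (lft t).length
      · have := copycatSet_extend_even hφ h3 (h4.symm ▸ hc) (h4.symm ▸ he)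
        exact ⟨u ++ [.snd c, .fst (φ c)], by simp [List.filterMap_cons, h1],
          by simp [List.filterMap_cons, h2], by simpa [List.filterMap_cons] using this⟩
      · have := copycatSet_extend_odd hφ h3 (h4.symm ▸ hc) (h4.symm ▸ he)
        exact ⟨u ++ [.fst (φ c), .snd c], by simp [List.filterMap_cons, h1],
          by simp [List.filterMap_cons, h2], by simpa [List.filterMap_cons] using this⟩

theorem mem_comp_copycat (hφ : CopyMap B C φ) (σ : Strategy (lolli A B))
    (t : List (A.Move ⊕ C.Move)) :
    t ∈ (compStrategy σ (copycat φ hφ)).carrier ↔ t.map (Sum.map id φ) ∈ σ.carrier := by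
  constructor
  · rintro ⟨u, h1, h2, rfl⟩
    exact post_copycat_forward _ u le_rfl (σ.subset_plays _ h1) h2 ▸ h1
  · intro h
    have h1 : t.map (Sum.map id φ) ∈ lolliPlays A B := σ.subset_plays _ h
    have h2 := h1.2.2
    rw [rgt_map, hφ.plays] at h2
    obtain ⟨u, h3, h4, h5⟩ := post_copycat_backward (A := A) hφ t h2
    exact ⟨u, h4 ▸ h, h5, h3⟩

theorem mem_copycat_comp (hφ : CopyMap B C φ) (τ : Strategy (lolli C D))
    (t : List (B.Move ⊕ D.Move)) :
    t ∈ (compStrategy (copycat φ hφ) τ).carrier ↔ ∃ s ∈ τ.carrier, s.map (Sum.map φ id) = t := by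
  constructor
  · rintro ⟨u, h1, h2, rfl⟩
    exact ⟨_, h2, (pre_copycat_forward _ u le_rfl (τ.subset_plays _ h2) h1).symm⟩
  · rintro ⟨s, hs, rfl⟩
    have h1 : s ∈ lolliPlays C D := τ.subset_plays _ hs
    obtain ⟨u, h3, h4, h5⟩ := pre_copycat_backward (D := D) hφ s h1.2.1
    exact ⟨u, h5, h3 ▸ hs, h4⟩

theorem copyMap_id (A : NegGame.{u}) : CopyMap A A id where
  inj := Function.injective_id
  plays := by simp
  exists_of_snoc := fun _ b _ _ => ⟨b, rfl⟩
  winning := fun _ h => h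

end Copycat

/-- The identity strategy. -/
def idStrategy (A : NegGame.{u}) : Strategy (lolli A A) := copycat id (copyMap_id A)

theorem map_sum_id {α β : Type*} (s : List (α ⊕ β)) : s.map (Sum.map id id) = s := by
  rw [Sum.map_id_id, List.map_id]

/-- The category of negative games and strategies. -/
instance : Category NegGame.{u} where
  Hom A B := Strategy (lolli A B)
  id A := idStrategy A
  comp σ τ := compStrategy σ τ
  id_comp σ := by
    apply Strategy.ext
    ext t
    exact (mem_copycat_comp _ σ t).trans
      ⟨fun ⟨s, hs, e⟩ => ((map_sum_id s).symm.trans e) ▸ hs, fun h => ⟨t, h, map_sum_id t⟩⟩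
  comp_id σ := by
    apply Strategy.ext
    ext t
    exact (mem_comp_copycat _ σ t).trans
      (iff_of_eq (congrArg (· ∈ σ.carrier) (map_sum_id t)))
  assoc := compStrategy_assoc

/-- Parallel strategies are ordered by inclusion. -/
instance (A B : NegGame.{u}) : PartialOrder (A ⟶ B) :=
  inferInstanceAs (PartialOrder (Strategy (lolli A B)))

theorem comp_mono {A B C : NegGame.{u}} {σ σ' : A ⟶ B} {τ τ' : B ⟶ C} (h1 : σ ≤ σ')
    (h2 : τ ≤ τ') : σ ≫ τ ≤ σ' ≫ τ' := compStrategy_mono h1 h2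

/-! ### Infinite plays -/

section Streams

variable {α β γ : Type*}

theorem pre_pfx (s : ℕ → α) {m n : ℕ} (h : m ≤ n) : ∃ t, pre s n = pre s m ++ t := by
  induction n, h using Nat.le_induction with
  | base => exact ⟨[], by simp⟩
  | succ n _ ih =>
    obtain ⟨t, ht⟩ := ih
    exact ⟨t ++ [s n], by rw [pre_succ, ht, List.append_assoc]⟩

theorem getElem?_pre (s : ℕ → α) {n k : ℕ} (h : k < n) : (pre s n)[k]? = some (s k) := by
  simp [pre, h]

theorem pre_eq_of_append {s : ℕ → α} {n : ℕ} {l t : List α} (h : pre s n = l ++ t) :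
    l = pre s l.length := by
  have hl : l.length ≤ n := by
    have := congrArg List.length h
    rw [pre_length, List.length_append] at this
    omega
  obtain ⟨t', ht'⟩ := pre_pfx s hl
  rw [h] at ht'
  exact (List.append_inj ht' (by rw [pre_length])).1

/-- The limit of an increasing sequence of finite sequences of unbounded length. -/
theorem exists_limit (l : ℕ → List α) (hl : ∀ n, ∃ t, l (n + 1) = l n ++ t)
    (hu : ∀ k, ∃ n, k ≤ (l n).length) : ∃ z : ℕ → α, ∀ n, l n = pre z (l n).length := by
  have hmono : ∀ m n, m ≤ n → ∃ t, l n = l m ++ t := by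
    intro m n h
    induction n, h using Nat.le_induction with
    | base => exact ⟨[], by simp⟩
    | succ n _ ih =>
      obtain ⟨t, ht⟩ := ih
      obtain ⟨t', ht'⟩ := hl n
      exact ⟨t ++ t', by rw [ht', ht, List.append_assoc]⟩
  have hz : ∀ k : ℕ, ∃ (x : α) (n : ℕ), (l n)[k]? = some x := by
    intro k
    obtain ⟨n, hn⟩ := hu (k + 1)
    exact ⟨(l n)[k], n, by simp⟩
  choose z N hzN using hz
  refine ⟨z, fun n => ?_⟩
  apply List.ext_getElem?
  intro k
  by_cases hk : k < (l n).length
  · rw [getElem?_pre z hk, ← hzN k]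
    have hk' : k < (l (N k)).length := by
      by_contra h
      have := hzN k
      rw [List.getElem?_eq_none (by omega)] at this
      cases this
    rcases le_total n (N k) with h | h
    · obtain ⟨t, ht⟩ := hmono _ _ h
      rw [ht, List.getElem?_append_left hk]
    · obtain ⟨t, ht⟩ := hmono _ _ h
      rw [ht, List.getElem?_append_left hk']
  · rw [List.getElem?_eq_none (by omega), List.getElem?_eq_none (by rw [pre_length]; omega)]

/-- The restriction of the first `n` members of `s` along `f`. -/
def filt (f : α → Option β) (s : ℕ → α) (n : ℕ) : List β := (pre s n).filterMap f

theorem filt_pfx (f : α → Option β) (s : ℕ → α) {m n : ℕ} (h : m ≤ n) :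
    ∃ t, filt f s n = filt f s m ++ t := by
  obtain ⟨t, ht⟩ := pre_pfx s h
  exact ⟨t.filterMap f, by rw [filt, ht, List.filterMap_append]; rfl⟩

theorem filt_le (f : α → Option β) (s : ℕ → α) {m n : ℕ} (h : m ≤ n) :
    (filt f s m).length ≤ (filt f s n).length := by
  obtain ⟨t, ht⟩ := filt_pfx f s h
  rw [ht, List.length_append]
  omega

theorem filt_succ_le (f : α → Option β) (s : ℕ → α) (n : ℕ) :
    (filt f s (n + 1)).length ≤ (filt f s n).length + 1 := by
  rw [filt, pre_succ, List.filterMap_append, List.length_append]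
  have : ([s n].filterMap f).length ≤ 1 := List.length_filterMap_le f [s n]
  exact Nat.add_le_add_left this _

theorem filt_eq_of_length (f : α → Option β) (s : ℕ → α) {m n : ℕ}
    (h : (filt f s m).length = (filt f s n).length) : filt f s m = filt f s n := by
  rcases le_total m n with h' | h'
  · obtain ⟨t, ht⟩ := filt_pfx f s h'
    rw [ht, List.length_append] at h
    have : t = [] := List.eq_nil_of_length_eq_zero (by omega)
    rw [ht, this, List.append_nil]
  · obtain ⟨t, ht⟩ := filt_pfx f s h'
    rw [ht, List.length_append] at h
    have : t = [] := List.eq_nil_of_length_eq_zero (by omega)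
    rw [ht, this, List.append_nil]

theorem exists_filt_length (f : α → Option β) (s : ℕ → α) {k n : ℕ}
    (h : k ≤ (filt f s n).length) : ∃ m ≤ n, (filt f s m).length = k := by
  induction n with
  | zero => exact ⟨0, le_rfl, by simp [filt, pre] at *; omega⟩
  | succ n ih =>
    by_cases h' : k ≤ (filt f s n).length
    · obtain ⟨m, hm, e⟩ := ih h'
      exact ⟨m, by omega, e⟩
    · have := filt_succ_le f s n
      exact ⟨n + 1, le_rfl, by omega⟩

/-- The infinite sequence `t` is the restriction of `s` along `f`. -/
def RestrTo (f : α → Option β) (s : ℕ → α) (t : ℕ → β) : Prop :=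
  ∀ k, ∃ n, filt f s n = pre t k

/-- The finite sequence `l` is the restriction of `s` along `f`. -/
def RestrFin (f : α → Option β) (s : ℕ → α) (l : List β) : Prop :=
  ∃ N, ∀ n ≥ N, filt f s n = l

theorem RestrTo.filt_eq {f : α → Option β} {s : ℕ → α} {t : ℕ → β} (h : RestrTo f s t) (n : ℕ) :
    filt f s n = pre t (filt f s n).length := by
  obtain ⟨m, hm⟩ := h (filt f s n).length
  rw [← hm]
  exact filt_eq_of_length f s (by rw [hm, pre_length])

theorem RestrTo.unbounded {f : α → Option β} {s : ℕ → α} {t : ℕ → β} (h : RestrTo f s t) (k : ℕ) :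
    ∃ n, k ≤ (filt f s n).length := by
  obtain ⟨n, hn⟩ := h k
  exact ⟨n, by rw [hn, pre_length]⟩

theorem restrTo_of {f : α → Option β} {s : ℕ → α} {t : ℕ → β}
    (h : ∀ k, ∃ n, k ≤ (filt f s n).length) (h' : ∀ n, filt f s n = pre t (filt f s n).length) :
    RestrTo f s t := by
  intro k
  obtain ⟨n, hn⟩ := h k
  obtain ⟨m, _, hm⟩ := exists_filt_length f s hn
  exact ⟨m, by rw [h' m, hm]⟩

theorem exists_restrTo {f : α → Option β} {s : ℕ → α} (h : ∀ k, ∃ n, k ≤ (filt f s n).length) :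
    ∃ t, RestrTo f s t := by
  obtain ⟨t, ht⟩ := exists_limit (filt f s) (fun n => filt_pfx f s (Nat.le_succ n)) h
  exact ⟨t, restrTo_of h ht⟩

theorem exists_restrFin {f : α → Option β} {s : ℕ → α}
    (h : ¬ ∀ k, ∃ n, k ≤ (filt f s n).length) : ∃ l, RestrFin f s l := by
  push Not at h
  obtain ⟨k, hk⟩ := h
  induction k with
  | zero => exact absurd (hk 0) (by omega)
  | succ k ih =>
    by_cases h' : ∀ n, (filt f s n).length < k
    · exact ih h'
    · push Not at h'
      obtain ⟨N, hN⟩ := h'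
      refine ⟨filt f s N, N, fun n hn => filt_eq_of_length f s ?_⟩
      have := hk n
      have := hk N
      have := filt_le f s hn
      omega

theorem RestrTo.not_fin {f : α → Option β} {s : ℕ → α} {t : ℕ → β} (h : RestrTo f s t)
    {l : List β} (h' : RestrFin f s l) : False := by
  obtain ⟨N, hN⟩ := h'
  obtain ⟨n, hn⟩ := h.unbounded (l.length + 1)
  have := filt_le f s (le_max_right N n)
  rw [hN _ (le_max_left _ _)] at this
  omega

theorem RestrFin.unique {f : α → Option β} {s : ℕ → α} {l l' : List β} (h : RestrFin f s l)
    (h' : RestrFin f s l') : l = l' := by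
  obtain ⟨N, hN⟩ := h
  obtain ⟨N', hN'⟩ := h'
  rw [← hN _ (le_max_left N N'), hN' _ (le_max_right N N')]

theorem filt_filt {f : α → Option β} {g : β → Option γ} {s : ℕ → α} {t : ℕ → β}
    (h : RestrTo f s t) (n : ℕ) :
    filt (fun a => (f a).bind g) s n = filt g t (filt f s n).length := by
  rw [filt, filt, ← h.filt_eq, filt, List.filterMap_filterMap]

theorem RestrTo.restrTo_iff {f : α → Option β} {g : β → Option γ} {s : ℕ → α} {t : ℕ → β}
    (h : RestrTo f s t) (r : ℕ → γ) :
    RestrTo g t r ↔ RestrTo (fun a => (f a).bind g) s r := by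
  constructor
  · intro h' k
    obtain ⟨n, hn⟩ := h' k
    obtain ⟨m, hm⟩ := h n
    exact ⟨m, by rw [filt_filt h, hm, pre_length, hn]⟩
  · intro h' k
    obtain ⟨n, hn⟩ := h' k
    exact ⟨_, by rw [← filt_filt h, hn]⟩

theorem RestrTo.restrFin_iff {f : α → Option β} {g : β → Option γ} {s : ℕ → α} {t : ℕ → β}
    (h : RestrTo f s t) (l : List γ) :
    RestrFin g t l ↔ RestrFin (fun a => (f a).bind g) s l := by
  constructor
  · rintro ⟨N, hN⟩
    obtain ⟨M, hM⟩ := h.unbounded N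
    refine ⟨M, fun n hn => ?_⟩
    rw [filt_filt h]
    exact hN _ (hM.trans (filt_le f s hn))
  · rintro ⟨N, hN⟩
    refine ⟨(filt f s N).length, fun n hn => ?_⟩
    obtain ⟨m', hm'⟩ := h.unbounded n
    obtain ⟨m, -, hm⟩ := exists_filt_length f s hm'
    have h1 := hN _ (le_max_left N m)
    rw [filt_filt h] at h1
    rcases le_total N m with h2 | h2
    · rw [max_eq_right h2, hm] at h1
      exact h1
    · rw [max_eq_left h2] at h1
      have := filt_le f s h2
      rw [show n = (filt f s N).length by omega]
      exact h1

end Streams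

section Winning

variable {A B C : NegGame.{u}}

theorem NegGame.winsOn_iff (A : NegGame.{u}) {α : Type*} (f : α → Option A.Move) (s : ℕ → α) :
    A.WinsOn f s ↔ (∃ t ∈ A.winning, RestrTo f s t) ∨ ∃ l ∈ A.finWinning, RestrFin f s l := Iff.rfl

theorem NegGame.mem_finWinning (A : NegGame.{u}) {l : List A.Move} :
    l ∈ A.finWinning ↔ l ∈ A.plays ∧ Even l.length := by
  refine and_congr_right fun h => ?_
  rcases List.eq_nil_or_concat l with rfl | ⟨p, m, rfl⟩
  · simp
  · rw [List.concat_eq_append] at *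
    have := A.lam_of_snoc h
    by_cases he : Even p.length
    · rw [turn_even he] at this
      simp [this, Nat.even_add_one, he]
    · rw [turn_odd he] at this
      simp [this, Nat.even_add_one, he]

theorem RestrTo.winsOn_iff {α β : Type*} {f : α → Option β} {s : ℕ → α} {t : ℕ → β}
    (h : RestrTo f s t) (g : β → Option A.Move) :
    A.WinsOn g t ↔ A.WinsOn (fun a => (f a).bind g) s := by
  simp only [NegGame.winsOn_iff, h.restrTo_iff, h.restrFin_iff]

theorem lam_player_iff {s : ℕ → A.Move} (h : ∀ n, pre s n ∈ A.plays) (n : ℕ) :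
    A.lam (s n) = .P ↔ ¬ Even n := by
  have h1 := h (n + 1)
  rw [pre_succ] at h1
  have := A.lam_of_snoc h1
  rw [pre_length] at this
  rw [this]
  by_cases he : Even n
  · simp [turn_even he, he]
  · simp [turn_odd he, he]

/-- A reformulation of the winning condition. -/
theorem isWinning_iff (σ : Strategy A) : σ.IsWinning ↔ σ.IsTotal ∧
    ∀ s : ℕ → A.Move, (∀ n, pre s n ∈ A.plays) → (∀ n, Even n → pre s n ∈ σ.carrier) →
      s ∈ A.winning := by
  refine and_congr_right fun _ => forall_congr' fun s => forall_congr' fun h => ?_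
  refine imp_congr_left ?_
  constructor
  · intro h' n hn
    rcases n with _ | n
    · exact σ.nil_mem
    · exact h' n ((lam_player_iff h n).2 (by simpa [Nat.even_add_one] using hn))
  · intro h' n hn
    exact h' _ (by simpa [Nat.even_add_one] using (lam_player_iff h n).1 hn)

/-- What the winning condition of a strategy on `A ⊸ B` says about the restriction of an infinite
sequence to a play of this strategy. -/
theorem wins_of_restr {α : Type*} {σ : Strategy (lolli A B)} (hσ : σ.IsWinning)
    (f : α → Option (A.Move ⊕ B.Move)) (s : ℕ → α) (h1 : ∀ n, filt f s n ∈ lolliPlays A B)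
    (h2 : ∀ n, Even (filt f s n).length → filt f s n ∈ σ.carrier)
    (h3 : ∀ l, RestrFin f s l → Even l.length) :
    B.WinsOn (fun a => (f a).bind Sum.getRight?) s ∨
      ¬ A.WinsOn (fun a => (f a).bind Sum.getLeft?) s := by
  by_cases h : ∀ k, ∃ n, k ≤ (filt f s n).length
  · obtain ⟨t, ht⟩ := exists_restrTo h
    rw [← ht.winsOn_iff, ← ht.winsOn_iff]
    refine (((isWinning_iff σ).1 hσ).2 t ?_ ?_).2
    · intro n
      obtain ⟨m, hm⟩ := ht n
      exact hm ▸ h1 m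
    · intro n hn
      obtain ⟨m, hm⟩ := ht n
      have := h2 m (by rw [hm, pre_length]; exact hn)
      rw [hm] at this
      exact this
  · obtain ⟨l, hl⟩ := exists_restrFin h
    have h4 := h3 l hl
    obtain ⟨N, hN⟩ := hl
    have h5 : l ∈ lolliPlays A B := hN N le_rfl ▸ h1 N
    have h6 := lolli_parity h5
    rw [length_lft_rgt] at h4
    have hr : RestrFin (fun a => (f a).bind Sum.getRight?) s (rgt l) :=
      ⟨N, fun n hn => by rw [filt, ← List.filterMap_filterMap]; exact congrArg rgt (hN n hn)⟩
    have hl : RestrFin (fun a => (f a).bind Sum.getLeft?) s (lft l) :=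
      ⟨N, fun n hn => by rw [filt, ← List.filterMap_filterMap]; exact congrArg lft (hN n hn)⟩
    by_cases he : Even (rgt l).length
    · exact .inl (.inr ⟨_, B.mem_finWinning.2 ⟨h5.2.2, he⟩, hr⟩)
    · right
      rintro (⟨t, -, ht⟩ | ⟨l', hl', ht⟩)
      · exact RestrTo.not_fin ht hl
      · rw [RestrFin.unique ht hl, NegGame.mem_finWinning] at hl'
        have := hl'.2
        simp only [Nat.even_iff, Nat.odd_iff] at *
        omega

variable {σ : Strategy (lolli A B)} {τ : Strategy (lolli B C)}

theorem wins_of_compat (hσ : σ.IsWinning) (hτ : τ.IsWinning)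
    (z : ℕ → Tri A.Move B.Move C.Move) (h : ∀ n, Compat σ τ (pre z n))
    (h1 : ∀ l, RestrFin Tri.r12 z l → Even l.length)
    (h2 : ∀ l, RestrFin Tri.r23 z l → Even l.length) :
    C.WinsOn Tri.r3 z ∨ ¬ A.WinsOn Tri.r1 z := by
  have e1 := wins_of_restr hσ Tri.r12 z (fun n => (h n).1.1) (fun n => (h n).mem12) h1
  have e2 := wins_of_restr hτ Tri.r23 z (fun n => (h n).1.2) (fun n => (h n).mem23) h2
  have f1 : (fun a : Tri A.Move B.Move C.Move => (Tri.r12 a).bind Sum.getRight?) = Tri.r2 := by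
    funext x; cases x <;> rfl
  have f2 : (fun a : Tri A.Move B.Move C.Move => (Tri.r12 a).bind Sum.getLeft?) = Tri.r1 := by
    funext x; cases x <;> rfl
  have f3 : (fun a : Tri A.Move B.Move C.Move => (Tri.r23 a).bind Sum.getRight?) = Tri.r3 := by
    funext x; cases x <;> rfl
  have f4 : (fun a : Tri A.Move B.Move C.Move => (Tri.r23 a).bind Sum.getLeft?) = Tri.r2 := by
    funext x; cases x <;> rfl
  rw [f1, f2] at e1
  rw [f3, f4] at e2
  tauto

theorem Compat.extend (hσ : σ.IsTotal) (hτ : τ.IsTotal) {p : List (Tri A.Move B.Move C.Move)}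
    (h : Compat σ τ p) (ho : ¬ Even (p.filterMap Tri.r13).length) :
    ∃ m, Compat σ τ (p ++ [m]) := by
  have p12 := h.1.parity12
  have p23 := h.1.parity23
  have l13 := length_r13 p
  have l12 := length_r12 p
  have l23 := length_r23 p
  rcases h.1.odd_cases ho with ⟨h1, h2⟩ | ⟨h1, h2⟩
  · -- the first strategy is to move
    obtain ⟨q, x, hq⟩ : ∃ q x, p.filterMap Tri.r12 = q ++ [x] := by
      rcases List.eq_nil_or_concat (p.filterMap Tri.r12) with h3 | ⟨q, x, h3⟩
      · rw [h3] at h1; simp at h1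
      · exact ⟨q, x, by simpa using h3⟩
    have hq1 : q ∈ σ.carrier := by
      obtain ⟨p1, p2, rfl, h3, h4⟩ := List.filterMap_eq_append_iff.1 hq
      have := h.pfx.mem12
      rw [h3] at this
      apply this
      rw [hq] at h1
      simpa [Nat.even_add_one] using h1
    obtain ⟨(y : A.Move ⊕ B.Move), hy⟩ := hσ q hq1 x (hq ▸ h.1.1)
    have hy' : p.filterMap Tri.r12 ++ [y] ∈ σ.carrier := by
      rw [hq, List.append_assoc]; exact hy
    have hy'' : p.filterMap Tri.r12 ++ [y] ∈ lolliPlays A B := σ.subset_plays _ hy'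
    rcases y with a | b
    · obtain ⟨_, h3, h4⟩ := lolli_snoc_inl.1 hy''
      rw [Tri.lft_r12] at h3
      rw [Tri.rgt_r12] at h4
      refine ⟨.fst a, compat_snoc h (inter_snoc_fst.2 ⟨h.1, h3, h4⟩) ?_ ?_⟩
      · intro _; simpa [List.filterMap_cons] using hy'
      · intro h5
        simp only [List.filterMap_append, List.filterMap_cons, Tri.r23_fst, List.filterMap_nil,
          List.append_nil] at h5 ⊢
        exact h.mem23 h5
    · obtain ⟨_, h3, h4⟩ := lolli_snoc_inr.1 hy''
      rw [Tri.rgt_r12] at h3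
      rw [Tri.lft_r12] at h4
      have h6 : Odd (p.filterMap Tri.r3).length := by
        simp only [Nat.even_iff, Nat.odd_iff] at *
        omega
      refine ⟨.snd b, compat_snoc h (inter_snoc_snd.2 ⟨h.1, h3, h4, h6⟩) ?_ ?_⟩
      · intro _; simpa [List.filterMap_cons] using hy'
      · intro h5
        exfalso
        simp only [List.filterMap_append, List.filterMap_cons, Tri.r23_snd, List.filterMap_nil,
          List.length_append, List.length_singleton, Nat.even_add_one] at h5
        exact h5 h2
  · obtain ⟨q, x, hq⟩ : ∃ q x, p.filterMap Tri.r23 = q ++ [x] := by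
      rcases List.eq_nil_or_concat (p.filterMap Tri.r23) with h3 | ⟨q, x, h3⟩
      · rw [h3] at h2; simp at h2
      · exact ⟨q, x, by simpa using h3⟩
    have hq1 : q ∈ τ.carrier := by
      obtain ⟨p1, p2, rfl, h3, h4⟩ := List.filterMap_eq_append_iff.1 hq
      have := h.pfx.mem23
      rw [h3] at this
      apply this
      rw [hq] at h2
      simpa [Nat.even_add_one] using h2
    obtain ⟨(y : B.Move ⊕ C.Move), hy⟩ := hτ q hq1 x (hq ▸ h.1.2)
    have hy' : p.filterMap Tri.r23 ++ [y] ∈ τ.carrier := by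
      rw [hq, List.append_assoc]; exact hy
    have hy'' : p.filterMap Tri.r23 ++ [y] ∈ lolliPlays B C := τ.subset_plays _ hy'
    rcases y with b | c
    · obtain ⟨_, h3, h4⟩ := lolli_snoc_inl.1 hy''
      rw [Tri.lft_r23] at h3
      rw [Tri.rgt_r23] at h4
      have h6 : Even (p.filterMap Tri.r1).length := by
        simp only [Nat.even_iff, Nat.odd_iff] at *
        omega
      refine ⟨.snd b, compat_snoc h (inter_snoc_snd.2 ⟨h.1, h3, h6, h4⟩) ?_ ?_⟩
      · intro h5
        exfalso
        simp only [List.filterMap_append, List.filterMap_cons, Tri.r12_snd, List.filterMap_nil,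
          List.length_append, List.length_singleton, Nat.even_add_one] at h5
        exact h5 h1
      · intro _; simpa [List.filterMap_cons] using hy'
    · obtain ⟨_, h3, h4⟩ := lolli_snoc_inr.1 hy''
      rw [Tri.rgt_r23] at h3
      rw [Tri.lft_r23] at h4
      refine ⟨.thd c, compat_snoc h (inter_snoc_thd.2 ⟨h.1, h3, h4⟩) ?_ ?_⟩
      · intro h5
        simp only [List.filterMap_append, List.filterMap_cons, Tri.r12_thd, List.filterMap_nil,
          List.append_nil] at h5 ⊢
        exact h.mem12 h5
      · intro _; simpa [List.filterMap_cons] using hy'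

theorem compat_pre_of_limit {z : ℕ → Tri A.Move B.Move C.Move} {l : ℕ → List (Tri A.Move B.Move C.Move)}
    (hl : ∀ n, Compat σ τ (l n)) (hu : ∀ k, ∃ n, k ≤ (l n).length)
    (hz : ∀ n, l n = pre z (l n).length) (k : ℕ) : Compat σ τ (pre z k) := by
  obtain ⟨n, hn⟩ := hu k
  obtain ⟨t, ht⟩ := pre_pfx z hn
  have := hl n
  rw [hz n, ht] at this
  exact this.pfx

theorem comp_total (hσ : σ.IsWinning) (hτ : τ.IsWinning) : (compStrategy σ τ).IsTotal := by
  rintro _ ⟨u, h1, h2, rfl⟩ (m : A.Move ⊕ C.Move) hm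
  replace hm : u.filterMap Tri.r13 ++ [m] ∈ lolliPlays A C := hm
  by_contra hcon
  push Not at hcon
  have hc := compat_of_mem h1 h2
  have he := even_r13 h1 h2
  have p12 := hc.1.parity12
  have p23 := hc.1.parity23
  have l13 := length_r13 u
  have hs := hc.1.even_of_even he
  -- the interaction after the move of Opponent
  obtain ⟨w, hw, hw13⟩ : ∃ w, Compat σ τ w ∧ w.filterMap Tri.r13 = u.filterMap Tri.r13 ++ [m] := by
    rcases m with a | c
    · obtain ⟨_, h3, h4⟩ := lolli_snoc_inl.1 hm
      rw [Tri.lft_r13] at h3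
      rw [Tri.rgt_r13] at h4
      have l12 := length_r12 u
      have l23 := length_r23 u
      refine ⟨u ++ [.fst a], compat_snoc hc (inter_snoc_fst.2 ⟨hc.1, h3, ?_⟩) ?_ ?_,
        by simp [List.filterMap_cons]⟩
      · simp only [Nat.even_iff, Nat.odd_iff] at *
        omega
      · intro h5
        exfalso
        simp only [List.filterMap_append, List.filterMap_cons, Tri.r12_fst, List.filterMap_nil,
          List.length_append, List.length_singleton, Nat.even_add_one] at h5
        exact h5 hs.1
      · intro h5
        simp only [List.filterMap_append, List.filterMap_cons, Tri.r23_fst, List.filterMap_nil,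
          List.append_nil] at h5 ⊢
        exact h2
    · obtain ⟨_, h3, h4⟩ := lolli_snoc_inr.1 hm
      rw [Tri.rgt_r13] at h3
      rw [Tri.lft_r13] at h4
      have l12 := length_r12 u
      have l23 := length_r23 u
      refine ⟨u ++ [.thd c], compat_snoc hc (inter_snoc_thd.2 ⟨hc.1, h3, ?_⟩) ?_ ?_,
        by simp [List.filterMap_cons]⟩
      · simp only [Nat.even_iff, Nat.odd_iff] at *
        omega
      · intro h5
        simp only [List.filterMap_append, List.filterMap_cons, Tri.r12_thd, List.filterMap_nil,
          List.append_nil] at h5 ⊢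
        exact h1
      · intro h5
        exfalso
        simp only [List.filterMap_append, List.filterMap_cons, Tri.r23_thd, List.filterMap_nil,
          List.length_append, List.length_singleton, Nat.even_add_one] at h5
        exact h5 hs.2
  have hodd : ¬ Even (u.filterMap Tri.r13 ++ [m]).length := by
    rw [List.length_append, List.length_singleton, Nat.even_add_one]
    simpa using he
  -- all further moves are hidden
  have step : ∀ p : {p // Compat σ τ p ∧ p.filterMap Tri.r13 = u.filterMap Tri.r13 ++ [m]},
      ∃ b, Compat σ τ (p.1 ++ [.snd b]) := by
    rintro ⟨p, hp, hp13⟩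
    obtain ⟨y, hy⟩ := hp.extend hσ.1 hτ.1 (hp13.symm ▸ hodd)
    have key : ∀ x, (p ++ [y]).filterMap Tri.r13 = u.filterMap Tri.r13 ++ [m] ++ [x] → False := by
      intro x hx
      have h3 := hy.1.even_of_even (by
        rw [hx, List.length_append, List.length_singleton, Nat.even_add_one]; exact hodd)
      exact hcon x ⟨p ++ [y], hy.mem12 h3.1, hy.mem23 h3.2, by rw [hx, List.append_assoc]; rfl⟩
    cases y with
    | fst a => exact (key (.inl a) (by simp [List.filterMap_cons, hp13])).elim
    | thd c => exact (key (.inr c) (by simp [List.filterMap_cons, hp13])).elim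
    | snd b => exact ⟨b, hy⟩
  choose g hg using step
  let l : ℕ → {p // Compat σ τ p ∧ p.filterMap Tri.r13 = u.filterMap Tri.r13 ++ [m]} :=
    fun n => Nat.rec ⟨w, hw, hw13⟩
      (fun _ p => ⟨p.1 ++ [.snd (g p)], hg p, by simp [List.filterMap_cons, p.2.2]⟩) n
  have hl : ∀ n, (l (n + 1)).1 = (l n).1 ++ [.snd (g (l n))] := fun n => rfl
  have hlen : ∀ n, (l n).1.length = w.length + n := by
    intro n
    induction n with
    | zero => rfl
    | succ n ih => rw [hl, List.length_append, ih]; rfl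
  have hu : ∀ k, ∃ n, k ≤ (l n).1.length := fun k => ⟨k, by rw [hlen]; omega⟩
  obtain ⟨z, hz⟩ := exists_limit (fun n => (l n).1) (fun n => ⟨_, hl n⟩) hu
  have hcz := compat_pre_of_limit (l := fun n => (l n).1) (fun n => (l n).2.1) hu hz
  have h13 : RestrFin Tri.r13 z (u.filterMap Tri.r13 ++ [m]) := by
    refine ⟨w.length, fun n hn => ?_⟩
    obtain ⟨k, rfl⟩ := Nat.exists_eq_add_of_le hn
    rw [filt, ← hlen, ← hz]
    exact (l k).2.2
  have h2 : ∀ n, n ≤ (filt Tri.r2 z (w.length + n)).length := by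
    intro n
    rw [filt, ← hlen, ← hz]
    induction n with
    | zero => omega
    | succ n ih => rw [hl]; simpa [List.filterMap_cons] using ih
  have h12 : ∀ t, ¬ RestrFin Tri.r12 z t := by
    rintro t ⟨N, hN⟩
    have e1 := hN (w.length + (N + t.length + 1)) (by omega)
    have e2 := congrArg List.length e1
    rw [filt, length_r12] at e2
    have e3 := h2 (N + t.length + 1)
    rw [filt] at e3
    omega
  have h23 : ∀ t, ¬ RestrFin Tri.r23 z t := by
    rintro t ⟨N, hN⟩
    have e1 := hN (w.length + (N + t.length + 1)) (by omega)
    have e2 := congrArg List.length e1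
    rw [filt, length_r23] at e2
    have e3 := h2 (N + t.length + 1)
    rw [filt] at e3
    omega
  have hfin := wins_of_compat hσ hτ z hcz (fun t ht => (h12 t ht).elim) (fun t ht => (h23 t ht).elim)
  obtain ⟨N, hN⟩ := h13
  have hr1 : RestrFin Tri.r1 z (lft (u.filterMap Tri.r13 ++ [m])) :=
    ⟨N, fun n hn => by rw [filt, ← Tri.lft_r13]; exact congrArg lft (hN n hn)⟩
  have hr3 : RestrFin Tri.r3 z (rgt (u.filterMap Tri.r13 ++ [m])) :=
    ⟨N, fun n hn => by rw [filt, ← Tri.rgt_r13]; exact congrArg rgt (hN n hn)⟩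
  have hpar := lolli_parity hm
  rw [length_lft_rgt] at hodd
  rcases hfin with (⟨t, -, ht⟩ | ⟨t, ht, ht'⟩) | hA
  · exact RestrTo.not_fin ht hr3
  · rw [RestrFin.unique ht' hr3, NegGame.mem_finWinning] at ht
    have := ht.2
    simp only [Nat.even_iff, Nat.odd_iff] at *
    omega
  · refine hA (.inr ⟨_, A.mem_finWinning.2 ⟨hm.2.1, ?_⟩, hr1⟩)
    simp only [Nat.even_iff, Nat.odd_iff] at *
    omega

theorem comp_winning (hσ : σ.IsWinning) (hτ : τ.IsWinning) : (compStrategy σ τ).IsWinning := by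
  rw [isWinning_iff]
  refine ⟨comp_total hσ hτ, ?_⟩
  intro (y : ℕ → A.Move ⊕ C.Move) hy hy'
  refine ⟨hy, ?_⟩
  have hex : ∀ n, ∃ u : List (Tri A.Move B.Move C.Move), u.filterMap Tri.r12 ∈ σ.carrier ∧
      u.filterMap Tri.r23 ∈ τ.carrier ∧ u.filterMap Tri.r13 = pre y (2 * n + 2) :=
    fun n => hy' (2 * n + 2) (by simp [Nat.even_add])
  choose l hl1 hl2 hl3 using hex
  have hnext : ∀ n, ∃ t, l (n + 1) = l n ++ t := by
    intro n
    have e : (l (n + 1)).filterMap Tri.r13 =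
        pre y (2 * n + 2) ++ y (2 * n + 2) :: [y (2 * n + 3)] := by
      rw [hl3, show 2 * (n + 1) + 2 = 2 * n + 2 + 1 + 1 by ring, pre_succ, pre_succ]
      simp
    obtain ⟨p, m, s, e1, e2, _⟩ := exists_split e
    have hc := compat_of_mem (hl1 (n + 1)) (hl2 (n + 1))
    rw [e1] at hc
    have e3 : pre y (2 * n + 2) = pre y (2 * n + 1) ++ [y (2 * n + 1)] := pre_succ _ _
    obtain ⟨s', hs'⟩ := (compat_of_mem (hl1 n) (hl2 n)).deterministic hc.pfx
      (pre y (2 * n + 1)) _ _ ((hl3 n).trans e3) (e2.trans e3)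
      (by rw [pre_length]; simp [Nat.even_add_one]) (l n) [] (by simp)
    exact ⟨s' ++ m :: s, by rw [e1, hs', List.append_assoc]⟩
  have hlen : ∀ n, 2 * n + 2 ≤ (l n).length := by
    intro n
    have := List.length_filterMap_le (Tri.r13 (α := A.Move) (β := B.Move) (γ := C.Move)) (l n)
    rw [hl3, pre_length] at this
    exact this
  have hu : ∀ k, ∃ n, k ≤ (l n).length := fun k => ⟨k, by have := hlen k; omega⟩
  obtain ⟨z, hz⟩ := exists_limit l hnext hu
  have hcz := compat_pre_of_limit (fun n => compat_of_mem (hl1 n) (hl2 n)) hu hz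
  have h13 : RestrTo Tri.r13 z y := by
    have key : ∀ k, filt Tri.r13 z (l k).length = pre y (2 * k + 2) := by
      intro k
      rw [filt, ← hz, hl3]
    refine restrTo_of (fun k => ⟨(l k).length, ?_⟩) (fun n => ?_)
    · rw [key, pre_length]
      omega
    · obtain ⟨t, ht⟩ := filt_pfx Tri.r13 z (show n ≤ (l n).length by have := hlen n; omega)
      rw [key] at ht
      exact pre_eq_of_append ht
  have := wins_of_compat hσ hτ z hcz ?_ ?_
  · rw [h13.winsOn_iff, h13.winsOn_iff]
    have f3 : (fun a : Tri A.Move B.Move C.Move => (Tri.r13 a).bind Sum.getRight?) = Tri.r3 := by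
      funext x; cases x <;> rfl
    have f4 : (fun a : Tri A.Move B.Move C.Move => (Tri.r13 a).bind Sum.getLeft?) = Tri.r1 := by
      funext x; cases x <;> rfl
    rw [f3, f4]
    exact this
  · rintro t ⟨N, hN⟩
    have h1 := hN (l N).length (by have := hlen N; omega)
    rw [filt, ← hz] at h1
    rw [← h1]
    exact σ.even_length (hl1 N)
  · rintro t ⟨N, hN⟩
    have h1 := hN (l N).length (by have := hlen N; omega)
    rw [filt, ← hz] at h1
    rw [← h1]
    exact τ.even_length (hl2 N)

variable {φ : C.Move → B.Move}

theorem copycat_winning (hφ : CopyMap B C φ) : (copycat φ hφ).IsWinning := by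
  rw [isWinning_iff]
  constructor
  · rintro (s : List (B.Move ⊕ C.Move)) hs (m : B.Move ⊕ C.Move) hm
    replace hs : s ∈ copycatSet B C φ := hs
    replace hm : s ++ [m] ∈ lolliPlays B C := hm
    have e := copycatSet_eq hs
    rcases m with b | c
    · obtain ⟨_, h1, h2⟩ := lolli_snoc_inl.1 hm
      have h3 : (rgt s).map φ ++ [b] ∈ B.plays := e ▸ h1
      obtain ⟨c, rfl⟩ := hφ.exists_of_snoc (rgt s) b (by rintro h; rw [h] at h2; simp at h2) h3
      have h4 : rgt s ++ [c] ∈ C.plays := (hφ.plays _).1 (by simpa using h3)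
      have := copycatSet_extend_odd hφ hs h4 (Nat.not_even_iff_odd.2 h2)
      exact ⟨.inr c, by rw [List.append_assoc] at this; exact this⟩
    · obtain ⟨_, h1, h2⟩ := lolli_snoc_inr.1 hm
      rw [e, List.length_map] at h2
      have := copycatSet_extend_even hφ hs h1 h2
      exact ⟨.inl (φ c), by rw [List.append_assoc] at this; exact this⟩
  · intro (s : ℕ → B.Move ⊕ C.Move) hs hs'
    refine ⟨hs, or_iff_not_imp_right.2 fun h => ?_⟩
    rw [not_not] at h
    replace hs' : ∀ n, filt Sum.getLeft? s (2 * n) = (filt Sum.getRight? s (2 * n)).map φ :=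
      fun n => copycatSet_eq (hs' (2 * n) (by simp))
    have hlen : ∀ n, (filt Sum.getRight? s (2 * n)).length = n := by
      intro n
      have h1 := length_lft_rgt (pre s (2 * n))
      have h2 : (lft (pre s (2 * n))).length = ((rgt (pre s (2 * n))).map φ).length :=
        congrArg List.length (hs' n)
      rw [List.length_map] at h2
      rw [pre_length] at h1
      have : (rgt (pre s (2 * n))).length = n := by omega
      exact this
    have hub : ∀ k, ∃ n, k ≤ (filt Sum.getRight? s n).length :=
      fun k => ⟨2 * k, by rw [hlen]⟩
    obtain ⟨t, ht⟩ := exists_restrTo hub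
    have ht' : RestrTo Sum.getLeft? s (φ ∘ t) := by
      intro k
      refine ⟨2 * k, ?_⟩
      rw [hs' k, ht.filt_eq, hlen]
      simp [pre]
    left
    refine ⟨t, hφ.winning t ?_, ht⟩
    rcases h with ⟨r, hr, hr'⟩ | ⟨r, -, hr'⟩
    · have : r = φ ∘ t := by
        funext k
        have h1 := RestrTo.filt_eq hr' (2 * (k + 1))
        have h2 := ht'.filt_eq (2 * (k + 1))
        have h3 : (filt Sum.getLeft? s (2 * (k + 1))).length = k + 1 := by
          rw [hs', List.length_map, hlen]
        rw [h3] at h1 h2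
        have h4 := congrArg (fun l => l[k]?) (h1.symm.trans h2)
        simp only [getElem?_pre _ (Nat.lt_succ_self k)] at h4
        simpa using h4
      exact this ▸ hr
    · exact (ht'.not_fin hr').elim

end Winning

/-! ### Products -/

section Products

variable {A B C : NegGame.{u}} {I : Type u}

theorem pre_map {α β : Type*} (g : α → β) (t : ℕ → α) (n : ℕ) :
    pre (g ∘ t) n = (pre t n).map g := by
  simp [pre]

theorem even_length_map {α β : Type*} (f : α → β) {l : List α} (h : Even l.length) :
    Even (l.map f).length := by rwa [List.length_map]

/-- The moves of a member of a family of games, tagged with the index. -/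
def tag (N : I → NegGame.{u}) (i : I) (m : (N i).Move) : Σ i, (N i).Move := ⟨i, m⟩

/-- The valid plays of the product of a family of games: the plays of one of the games, tagged
with its index. (The empty play is a valid play also if the family is empty.) -/
def prodPlays (N : I → NegGame.{u}) : Set (List (Σ i, (N i).Move)) :=
  {s | s = [] ∨ ∃ i, ∃ t ∈ (N i).plays, s = t.map (tag N i)}

/-- The product of a family of negative games. -/
def prodGame (N : I → NegGame.{u}) : NegGame.{u} where
  Move := Σ i, (N i).Move
  lam := fun m => (N m.1).lam m.2
  plays := prodPlays N
  plays_nonempty := ⟨[], .inl rfl⟩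
  plays_prefix := by
    rintro s t (h | ⟨i, r, hr, h⟩)
    · exact .inl (List.append_eq_nil_iff.1 h).1
    · obtain ⟨r1, r2, rfl, rfl, rfl⟩ := List.map_eq_append_iff.1 h.symm
      exact .inr ⟨i, r1, (N i).plays_prefix _ _ hr, rfl⟩
  plays_alternating := by
    rintro s (rfl | ⟨i, r, hr, rfl⟩) k hk
    · exact absurd hk (by simp)
    · have h := (N i).plays_alternating r hr k (by simpa using hk)
      rw [List.getElem_map]
      exact h
  winning := {s | ∃ i, ∃ t ∈ (N i).winning, s = tag N i ∘ t}
  winning_plays := by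
    rintro s ⟨i, t, ht, rfl⟩ n
    exact .inr ⟨i, pre t n, (N i).winning_plays t ht n, pre_map (tag N i) t n⟩

theorem sigma_map_eq {N : I → NegGame.{u}} {i j : I} {s : List (N i).Move} {t : List (N j).Move}
    (hs : s ≠ []) (h : s.map (tag N i) = t.map (tag N j)) :
    i = j := by
  rcases s with _ | ⟨a, s⟩
  · exact absurd rfl hs
  · rcases t with _ | ⟨b, t⟩
    · simp at h
    · simp only [List.map_cons, List.cons.injEq] at h
      exact congrArg Sigma.fst h.1

theorem sigma_mk_inj {N : I → NegGame.{u}} (i : I) : Function.Injective (tag N i) :=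
  fun a b h => by cases h; rfl

theorem copyMap_sigma (N : I → NegGame.{u}) (i : I) :
    CopyMap (prodGame N) (N i) (tag N i) where
  inj := sigma_mk_inj i
  plays := by
    intro s
    constructor
    · rintro (h | ⟨j, t, ht, h⟩)
      · have : s = [] := List.map_eq_nil_iff.1 h
        exact this ▸ (N i).nil_mem
      · by_cases hs : s = []
        · exact hs ▸ (N i).nil_mem
        · obtain rfl := sigma_map_eq hs h
          rwa [List.map_injective_iff.2 (sigma_mk_inj i) h]
    · exact fun h => .inr ⟨i, s, h, rfl⟩
  exists_of_snoc := by
    rintro s b hs (h | ⟨j, t, ht, h⟩)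
    · exact absurd (List.append_eq_nil_iff.1 h).2 (by simp)
    · obtain ⟨t1, t2, rfl, h1, h2⟩ := List.map_eq_append_iff.1 h.symm
      obtain rfl := sigma_map_eq hs h1.symm
      obtain ⟨c, _, rfl⟩ := List.map_eq_singleton_iff.1 h2
      exact ⟨c, rfl⟩
  winning := by
    rintro t ⟨j, r, hr, h⟩
    have h1 := congrFun h 0
    have : i = j := congrArg Sigma.fst h1
    subst this
    have : t = r := by
      funext n
      exact sigma_mk_inj i (congrFun h n)
    exact this ▸ hr

/-- The projections from a product. -/
def proj (N : I → NegGame.{u}) (i : I) : prodGame N ⟶ N i :=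
  copycat (tag N i) (copyMap_sigma N i)

theorem map_mem_lolliPlays {φ : C.Move → B.Move} (hφ : CopyMap B C φ)
    {t : List (A.Move ⊕ C.Move)} :
    t.map (Sum.map id φ) ∈ lolliPlays A B ↔ t ∈ lolliPlays A C := by
  induction t using List.reverseRecOn with
  | nil => exact iff_of_true (lolli A B).nil_mem (lolli A C).nil_mem
  | append_singleton t m ih =>
    rw [List.map_append]
    cases m with
    | inl a =>
      have : List.map (Sum.map id φ) [(Sum.inl a : A.Move ⊕ C.Move)] = [Sum.inl a] := rfl
      rw [this, lolli_snoc_inl, lolli_snoc_inl, ih, lft_map, rgt_map, List.length_map]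
    | inr c =>
      have : List.map (Sum.map id φ) [(Sum.inr c : A.Move ⊕ C.Move)] = [Sum.inr (φ c)] := rfl
      rw [this, lolli_snoc_inr, lolli_snoc_inr, ih, lft_map, rgt_map, ← hφ.plays]
      simp

theorem rgt_ne_nil {t : List (A.Move ⊕ B.Move)} (ht : t ∈ lolliPlays A B) (h : t ≠ []) :
    rgt t ≠ [] := by
  rcases t with _ | ⟨m, t⟩
  · exact absurd rfl h
  · have h1 : ([] : List (A.Move ⊕ B.Move)) ++ [m] ∈ lolliPlays A B := lolli_prefix (t := t) ht
    cases m with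
    | inl a =>
      have := (lolli_snoc_inl.1 h1).2.2
      simp at this
    | inr b => simp

theorem exists_of_rgt_eq {α β γ : Type*} {f : γ → β} (s : List (α ⊕ β)) (r : List γ)
    (h : rgt s = r.map f) : ∃ t : List (α ⊕ γ), s = t.map (Sum.map id f) := by
  induction s generalizing r with
  | nil => exact ⟨[], rfl⟩
  | cons m s ih =>
    cases m with
    | inl a =>
      obtain ⟨t, rfl⟩ := ih r (by simpa using h)
      exact ⟨.inl a :: t, rfl⟩
    | inr b =>
      rcases r with _ | ⟨c, r⟩
      · simp at h
      · simp only [rgt_cons_inr, List.map_cons, List.cons.injEq] at h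
        obtain ⟨t, rfl⟩ := ih r h.2
        exact ⟨.inr c :: t, by simp [h.1]⟩

theorem sum_map_inj {α β γ : Type*} {f : γ → β} (hf : Function.Injective f) :
    Function.Injective (List.map (Sum.map (id : α → α) f)) :=
  List.map_injective_iff.2 (Function.injective_id.sumMap hf)

variable {N : I → NegGame.{u}}

theorem index_unique {i j : I} {t : List (A.Move ⊕ (N i).Move)} {t' : List (A.Move ⊕ (N j).Move)}
    (ht : t ∈ lolliPlays A (N i)) (hne : t ≠ [])
    (h : t.map (Sum.map id (tag N i)) =
      t'.map (Sum.map id (tag N j))) : i = j := by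
  have h1 := congrArg rgt h
  rw [rgt_map, rgt_map] at h1
  exact sigma_map_eq (rgt_ne_nil ht hne) h1

/-- The plays of the pairing of a family of strategies: plays of one of them, tagged. -/
def pairingSet (σ : ∀ i, Strategy (lolli A (N i))) : Set (List (A.Move ⊕ Σ i, (N i).Move)) :=
  {s | s = [] ∨ ∃ i, ∃ t ∈ (σ i).carrier, s = List.map (Sum.map id (tag N i)) t}

theorem mem_pairingSet (σ : ∀ i, Strategy (lolli A (N i))) {i : I}
    {t : List (A.Move ⊕ (N i).Move)} :
    t.map (Sum.map id (tag N i)) ∈ pairingSet σ ↔ t ∈ (σ i).carrier := by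
  constructor
  · rintro (h | ⟨j, t', ht', h⟩)
    · have : t = [] := List.map_eq_nil_iff.1 h
      exact this ▸ (σ i).nil_mem
    · by_cases hs : t' = []
      · subst hs
        have : t = [] := List.map_eq_nil_iff.1 (by rw [h]; rfl)
        exact this ▸ (σ i).nil_mem
      · obtain rfl := index_unique ((σ j).subset_plays _ ht') hs h.symm
        rwa [sum_map_inj (sigma_mk_inj j) h]
  · exact fun h => .inr ⟨i, t, h, rfl⟩

theorem pairingSet_plays (σ : ∀ i, Strategy (lolli A (N i)))
    {s : List (A.Move ⊕ Σ i, (N i).Move)} (h : s ∈ pairingSet σ) :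
    s ∈ lolliPlays A (prodGame N) ∧ Even s.length := by
  rcases h with rfl | ⟨i, t, ht, rfl⟩
  · exact ⟨(lolli A (prodGame N)).nil_mem, by simp⟩
  · exact ⟨(map_mem_lolliPlays (copyMap_sigma N i)).2 ((σ i).subset_plays _ ht),
      even_length_map _ ((σ i).even_length ht)⟩

theorem exists_of_mem_lolliPlays {s : List (A.Move ⊕ Σ i, (N i).Move)}
    (hs : s ∈ lolliPlays A (prodGame N)) (hne : s ≠ []) :
    ∃ i, ∃ t ∈ lolliPlays A (N i), s = List.map (Sum.map id (tag N i)) t := by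
  have h1 := rgt_ne_nil hs hne
  rcases hs.2.2 with h2 | ⟨i, r, hr, h2⟩
  · exact absurd h2 h1
  · obtain ⟨t, rfl⟩ := exists_of_rgt_eq s r h2
    exact ⟨i, t, (map_mem_lolliPlays (copyMap_sigma N i)).1 hs, rfl⟩

/-- The pairing of a family of strategies. -/
def pairing (σ : ∀ i, A ⟶ N i) : A ⟶ prodGame N where
  carrier := pairingSet σ
  subset_plays := fun s hs => (pairingSet_plays σ hs).1
  last_player := by
    rintro (s : List (A.Move ⊕ Σ i, (N i).Move)) (a : A.Move ⊕ Σ i, (N i).Move) h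
    obtain ⟨h1, h2⟩ := pairingSet_plays σ (s := s ++ [a]) h
    rw [(lolli A (prodGame N)).lam_of_snoc (s := s) (m := a) h1]
    apply turn_odd
    change ¬ Even (List.length (α := A.Move ⊕ Σ i, (N i).Move) s)
    simpa [Nat.even_add_one] using h2
  prefix_closed := by
    rintro (s : List (A.Move ⊕ Σ i, (N i).Move)) (a : A.Move ⊕ Σ i, (N i).Move)
      (b : A.Move ⊕ Σ i, (N i).Move) h
    have h1 := (pairingSet_plays σ (s := s ++ [a, b]) h).2
    rcases h with h | ⟨i, t, ht, h⟩
    · exact absurd (List.append_eq_nil_iff.1 h).2 (by simp)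
    · obtain ⟨t1, t2, rfl, rfl, e⟩ := List.map_eq_append_iff.1 h.symm
      refine .inr ⟨i, t1, Strategy.even_prefix (σ i) ht ?_, rfl⟩
      have h2 : Even (t1.length + 2) := by
        rw [List.length_append, List.length_map] at h1
        exact h1
      have h3 : Even t1.length := by simpa [Nat.even_add] using h2
      exact h3
  deterministic := by
    rintro (s : List (A.Move ⊕ Σ i, (N i).Move)) (a : A.Move ⊕ Σ i, (N i).Move)
      (b : A.Move ⊕ Σ i, (N i).Move) h h'
    have h1 := (pairingSet_plays σ (s := s ++ [a]) h).2
    have hne : s ≠ [] := by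
      rintro rfl
      simp at h1
    have h2 := (pairingSet_plays σ (s := s ++ [a]) h).1
    rcases h with h | ⟨i, t, ht, h⟩
    · exact absurd (List.append_eq_nil_iff.1 h).2 (by simp)
    rcases h' with h' | ⟨j, t', ht', h'⟩
    · exact absurd (List.append_eq_nil_iff.1 h').2 (by simp)
    obtain ⟨t1, t2, rfl, rfl, e⟩ := List.map_eq_append_iff.1 h.symm
    obtain ⟨t1', t2', rfl, e1, e'⟩ := List.map_eq_append_iff.1 h'.symm
    obtain ⟨x, rfl, rfl⟩ := List.map_eq_singleton_iff.1 e
    obtain ⟨y, rfl, rfl⟩ := List.map_eq_singleton_iff.1 e'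
    have hne' : t1 ≠ [] := fun h => hne (by rw [h]; rfl)
    obtain rfl := index_unique (lolli_prefix ((σ i).subset_plays _ ht)) hne' e1.symm
    obtain rfl := sum_map_inj (sigma_mk_inj i) e1
    rw [(σ i).deterministic _ _ _ ht ht']
  nonempty := ⟨[], .inl rfl⟩

theorem pairing_proj (σ : ∀ i, A ⟶ N i) (i : I) : pairing σ ≫ proj N i = σ i := by
  apply Strategy.ext
  ext t
  exact (mem_comp_copycat (copyMap_sigma N i) (pairing σ) t).trans (mem_pairingSet σ)

theorem le_of_proj {σ τ : A ⟶ prodGame N} (h : ∀ i, σ ≫ proj N i ≤ τ ≫ proj N i) : σ ≤ τ := by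
  intro (s : List (A.Move ⊕ Σ i, (N i).Move)) hs
  by_cases hne : s = []
  · subst hne
    exact τ.nil_mem
  · obtain ⟨i, t, ht, rfl⟩ := exists_of_mem_lolliPlays (σ.subset_plays s hs) hne
    exact (mem_comp_copycat (copyMap_sigma N i) τ t).1
      (h i ((mem_comp_copycat (copyMap_sigma N i) σ t).2 hs))

theorem eq_of_proj {σ τ : A ⟶ prodGame N} (h : ∀ i, σ ≫ proj N i = τ ≫ proj N i) : σ = τ :=
  le_antisymm (le_of_proj fun i => (h i).le) (le_of_proj fun i => (h i).ge)

/-- The strategy that never makes a move. -/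
def empStrategy (A B : NegGame.{u}) : A ⟶ B where
  carrier := {[]}
  subset_plays := by
    rintro s rfl
    exact (lolli A B).nil_mem
  last_player := fun s a h => absurd (List.append_eq_nil_iff.1 h).2 (by simp)
  prefix_closed := fun s a b h => absurd (List.append_eq_nil_iff.1 h).2 (by simp)
  deterministic := fun s a b h => absurd (List.append_eq_nil_iff.1 h).2 (by simp)
  nonempty := ⟨[], rfl⟩

theorem empStrategy_le (σ : A ⟶ B) : empStrategy A B ≤ σ := by
  rintro s rfl
  exact σ.nil_mem

theorem comp_empStrategy (σ : A ⟶ B) : σ ≫ empStrategy B C = empStrategy A C := by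
  refine le_antisymm ?_ (empStrategy_le _)
  rintro s ⟨u, h1, h2, rfl⟩
  replace h2 : u.filterMap Tri.r23 = [] := h2
  have h3 : u.filterMap Tri.r12 = [] := by
    by_contra hne
    refine rgt_ne_nil (σ.subset_plays _ h1) hne ?_
    rw [Tri.rgt_r12, ← Tri.lft_r23, h2]
    rfl
  have h4 := congrArg List.length h3
  have h5 := congrArg List.length h2
  have h6 := length_r13 u
  rw [length_r12, List.length_nil] at h4
  rw [length_r23, List.length_nil] at h5
  exact List.eq_nil_of_length_eq_zero (by omega)

theorem proj_winning (N : I → NegGame.{u}) (i : I) : Strategy.IsWinning (proj N i) :=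
  copycat_winning (copyMap_sigma N i)

theorem pairing_winning {σ : ∀ i, A ⟶ N i} (hσ : ∀ i, Strategy.IsWinning (σ i)) :
    Strategy.IsWinning (pairing σ) := by
  rw [isWinning_iff]
  constructor
  · intro (s : List (A.Move ⊕ Σ i, (N i).Move)) hs (m : A.Move ⊕ Σ i, (N i).Move) hm
    obtain ⟨i, t, ht, h⟩ := exists_of_mem_lolliPlays (s := s ++ [m]) hm (by simp)
    obtain ⟨t1, t2, rfl, rfl, e⟩ := List.map_eq_append_iff.1 h.symm
    obtain ⟨x, rfl, rfl⟩ := List.map_eq_singleton_iff.1 e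
    obtain ⟨b, hb⟩ := (hσ i).1 t1 ((mem_pairingSet σ).1 hs) x ht
    refine ⟨Sum.map id (tag N i) b, .inr ⟨i, _, hb, ?_⟩⟩
    exact (List.map_append (f := Sum.map id (tag N i)) (l₁ := t1) (l₂ := [x, b])).symm
  · intro (s : ℕ → A.Move ⊕ Σ i, (N i).Move) hs hs'
    refine ⟨hs, ?_⟩
    replace hs : ∀ n, pre s n ∈ lolliPlays A (prodGame N) := hs
    obtain ⟨i, t1, ht1, h1⟩ := exists_of_mem_lolliPlays (hs 1) (by simp [pre])
    have hne : t1 ≠ [] := by rintro rfl; simp [pre] at h1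
    have key : ∀ n, ∃ x, s n = Sum.map id (tag N i) x := by
      intro n
      obtain ⟨j, t, ht, h⟩ := exists_of_mem_lolliPlays (hs (1 + n)) (by simp [pre])
      obtain ⟨r, hr⟩ := pre_pfx s (show 1 ≤ 1 + n by omega)
      rw [h] at hr
      obtain ⟨q1, q2, rfl, h2, h3⟩ := List.map_eq_append_iff.1 hr
      obtain rfl := index_unique ht1 hne (h1.symm.trans h2.symm)
      rw [add_comm, pre_succ] at h
      obtain ⟨p1, p2, _, _, h4⟩ := List.map_eq_append_iff.1 h.symm
      obtain ⟨x, _, hx⟩ := List.map_eq_singleton_iff.1 h4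
      exact ⟨x, hx.symm⟩
    choose t ht using key
    obtain rfl : s = Sum.map id (tag N i) ∘ t := funext ht
    have hw := ((isWinning_iff _).1 (hσ i)).2 t
      (fun n => (map_mem_lolliPlays (copyMap_sigma N i)).1 (pre_map _ t n ▸ hs n))
      (fun n hn => (mem_pairingSet σ).1 (pre_map (Sum.map id (tag N i)) t n ▸ hs' n hn))
    have hl : ∀ n, filt Sum.getLeft? (Sum.map id (tag N i) ∘ t) n = filt Sum.getLeft? t n := by
      intro n
      rw [filt, pre_map]
      exact lft_map _ _
    have hr : ∀ n, filt Sum.getRight? (Sum.map id (tag N i) ∘ t) n =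
        (filt Sum.getRight? t n).map (tag N i) := by
      intro n
      rw [filt, pre_map]
      exact rgt_map _ _
    refine Or.imp ?_ ?_ hw.2
    · rintro (⟨r, hr1, hr2⟩ | ⟨l, hl1, hl2⟩)
      · refine .inl ⟨tag N i ∘ r, ⟨i, r, hr1, rfl⟩, fun k => ?_⟩
        obtain ⟨n, hn⟩ := hr2 k
        refine ⟨n, (hr n).trans ?_⟩
        rw [filt, hn]
        exact (pre_map (tag N i) r k).symm
      · obtain ⟨M, hM⟩ := hl2
        refine .inr ⟨l.map (tag N i), ?_, M, fun n hn => (hr n).trans ?_⟩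
        · rw [NegGame.mem_finWinning] at hl1 ⊢
          exact ⟨.inr ⟨i, l, hl1.1, rfl⟩, even_length_map _ hl1.2⟩
        · rw [filt, hM n hn]
          rfl
    · refine mt ?_
      rintro (⟨r, hr1, hr2⟩ | ⟨l, hl1, M, hM⟩)
      · refine .inl ⟨r, hr1, fun k => ?_⟩
        obtain ⟨n, hn⟩ := hr2 k
        exact ⟨n, (hl n).symm.trans hn⟩
      · exact .inr ⟨l, hl1, M, fun n hn => (hl n).symm.trans (hM n hn)⟩

end Products

/-! ### Embeddings of games and uniform winning strategies -/

/-- An embedding-projection pair between games. -/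
@[ext] structure GameEmb (A B : NegGame.{u}) where
  emb : A ⟶ B
  prj : B ⟶ A
  emb_prj : emb ≫ prj = 𝟙 A
  prj_emb : prj ≫ emb ≤ 𝟙 B

/-- Negative games, as the objects of the category of embedding-projection pairs. -/
structure EmbGame : Type (u + 1) where
  game : NegGame.{u}

/-- The category of negative games and embedding-projection pairs. -/
instance : Category.{u} EmbGame.{u} where
  Hom A B := GameEmb A.game B.game
  id A := ⟨𝟙 _, 𝟙 _, Category.comp_id _, (Category.comp_id _).le⟩
  comp f g := ⟨f.emb ≫ g.emb, g.prj ≫ f.prj, by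
    rw [Category.assoc, ← Category.assoc g.emb, g.emb_prj, Category.id_comp, f.emb_prj], by
    rw [Category.assoc, ← Category.assoc f.prj]
    refine (comp_mono le_rfl (comp_mono f.prj_emb le_rfl)).trans ?_
    rw [Category.id_comp]
    exact g.prj_emb⟩
  id_comp f := GameEmb.ext (Category.id_comp _) (Category.comp_id _)
  comp_id f := GameEmb.ext (Category.comp_id _) (Category.id_comp _)
  assoc f g h := GameEmb.ext (Category.assoc _ _ _) (Category.assoc _ _ _).symm

theorem comp_emb {A B C : EmbGame.{u}} (f : A ⟶ B) (g : B ⟶ C) :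
    (f ≫ g).emb = f.emb ≫ g.emb := rfl

theorem comp_prj {A B C : EmbGame.{u}} (f : A ⟶ B) (g : B ⟶ C) :
    (f ≫ g).prj = g.prj ≫ f.prj := rfl

theorem GameEmb.empStrategy_emb {A B C : NegGame.{u}} (f : GameEmb A B) :
    empStrategy C A ≫ f.emb = empStrategy C B := by
  refine le_antisymm ?_ (empStrategy_le _)
  calc empStrategy C A ≫ f.emb ≤ (empStrategy C B ≫ f.prj) ≫ f.emb :=
        comp_mono (empStrategy_le _) le_rfl
    _ = empStrategy C B ≫ f.prj ≫ f.emb := Category.assoc _ _ _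
    _ ≤ empStrategy C B ≫ 𝟙 B := comp_mono le_rfl f.prj_emb
    _ = empStrategy C B := Category.comp_id _

section Uniform

variable {𝒞 : Type v} [Category.{w} 𝒞]

/-- A family of strategies from `F` to `G` is uniform if it is a lax natural transformation from
`F` to `G`, the embeddings of games being regarded as strategies. -/
def IsUniform {F G : 𝒞 ⥤ EmbGame.{u}} (σ : ∀ c, (F.obj c).game ⟶ (G.obj c).game) : Prop :=
  ∀ ⦃c d : 𝒞⦄ (f : c ⟶ d), σ c ≫ (G.map f).emb ≤ (F.map f).emb ≫ σ d

/-- Uniform winning strategies from `F` to `G`. -/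
@[ext] structure UniformWinning (F G : 𝒞 ⥤ EmbGame.{u}) where
  app : ∀ c, (F.obj c).game ⟶ (G.obj c).game
  uniform : IsUniform app
  winning : ∀ c, Strategy.IsWinning (app c)

/-- Families of games indexed functorially by `𝒞`, as the objects of the category of uniform
winning strategies. -/
structure UGames (𝒞 : Type v) [Category.{w} 𝒞] : Type (max v w (u + 1)) where
  fam : 𝒞 ⥤ EmbGame.{u}

/-- The category of functors from `𝒞` to games and embeddings, and of uniform winning strategies
between them. -/
instance : Category (UGames.{u} 𝒞) where
  Hom F G := UniformWinning F.fam G.fam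
  id F := ⟨fun _ => 𝟙 _, fun c d f => by rw [Category.id_comp, Category.comp_id],
    fun c => copycat_winning (copyMap_id _)⟩
  comp {F G H} σ τ := ⟨fun c => σ.app c ≫ τ.app c, fun c d f => by
    calc (σ.app c ≫ τ.app c) ≫ (H.fam.map f).emb
        = σ.app c ≫ τ.app c ≫ (H.fam.map f).emb := Category.assoc _ _ _
      _ ≤ σ.app c ≫ (G.fam.map f).emb ≫ τ.app d := comp_mono le_rfl (τ.uniform f)
      _ = (σ.app c ≫ (G.fam.map f).emb) ≫ τ.app d := (Category.assoc _ _ _).symm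
      _ ≤ ((F.fam.map f).emb ≫ σ.app d) ≫ τ.app d := comp_mono (σ.uniform f) le_rfl
      _ = (F.fam.map f).emb ≫ σ.app d ≫ τ.app d := Category.assoc _ _ _,
    fun c => comp_winning (σ.winning c) (τ.winning c)⟩
  id_comp σ := UniformWinning.ext (funext fun _ => Category.id_comp _)
  comp_id σ := UniformWinning.ext (funext fun _ => Category.comp_id _)
  assoc σ τ υ := UniformWinning.ext (funext fun _ => Category.assoc _ _ _)

/-- Reindexing of families of games and of uniform winning strategies along a functor. -/
def reindex {𝒟 : Type*} [Category 𝒟] (U : 𝒞 ⥤ 𝒟) : UGames.{u} 𝒟 ⥤ UGames.{u} 𝒞 where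
  obj F := ⟨U ⋙ F.fam⟩
  map σ := ⟨fun c => σ.app (U.obj c), fun _ _ f => σ.uniform (U.map f),
    fun c => σ.winning (U.obj c)⟩

end Uniform

/-! ### Families and injections -/

/-- Families of objects of `𝒞`, indexed by a set. -/
structure FamInj (𝒞 : Type v) : Type (max v (u + 1)) where
  Idx : Type u
  obj : Idx → 𝒞

/-- A morphism of families: an injection of the index sets, and morphisms between the members of
the families. -/
@[ext] structure FamInj.Hom {𝒞 : Type v} [Category.{w} 𝒞] (A B : FamInj.{u} 𝒞) where
  fn : A.Idx → B.Idx
  inj : Function.Injective fn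
  map : ∀ i, A.obj i ⟶ B.obj (fn i)

instance {𝒞 : Type v} [Category.{w} 𝒞] : Category.{max u w} (FamInj.{u} 𝒞) where
  Hom A B := FamInj.Hom A B
  id A := ⟨id, Function.injective_id, fun _ => 𝟙 _⟩
  comp f g := ⟨g.fn ∘ f.fn, g.inj.comp f.inj, fun i => f.map i ≫ g.map (f.fn i)⟩
  id_comp f := FamInj.Hom.ext rfl (heq_of_eq (funext fun _ => Category.id_comp _))
  comp_id f := FamInj.Hom.ext rfl (heq_of_eq (funext fun _ => Category.comp_id _))
  assoc f g h := FamInj.Hom.ext rfl (heq_of_eq (funext fun _ => Category.assoc _ _ _))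

/-- The action of `FamInj` on functors. -/
def FamInj.mapFunctor {𝒞 : Type v} [Category.{w} 𝒞] {𝒟 : Type v'} [Category.{w'} 𝒟] (F : 𝒞 ⥤ 𝒟) :
    FamInj.{u} 𝒞 ⥤ FamInj.{u} 𝒟 where
  obj A := ⟨A.Idx, fun i => F.obj (A.obj i)⟩
  map f := ⟨f.fn, f.inj, fun i => F.map (f.map i)⟩
  map_id A := FamInj.Hom.ext rfl (heq_of_eq (funext fun _ => F.map_id _))
  map_comp f g := FamInj.Hom.ext rfl (heq_of_eq (funext fun _ => F.map_comp _ _))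

section ProdFunctor

variable {A B C : FamInj.{u} EmbGame.{u}}

/-- The product of a family of games. -/
def famProd (A : FamInj.{u} EmbGame.{u}) : NegGame.{u} := prodGame fun i => (A.obj i).game

/-- The projections from the product of a family of games. -/
def famProj (A : FamInj.{u} EmbGame.{u}) (i : A.Idx) : famProd A ⟶ (A.obj i).game :=
  proj (fun i => (A.obj i).game) i

open Classical in
/-- The components of the embedding of products induced by a morphism `f` of families: the
component at an index of the form `f j` is the projection to `j` followed by the embedding at `j`,
and the component at an index that is not in the image of `f` is the empty strategy. -/
noncomputable def prodEmbComp (f : A ⟶ B) (h : B.Idx) : famProd A ⟶ (B.obj h).game :=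
  if e : ∃ j, f.fn j = h then
    (famProj A e.choose ≫ (f.map e.choose).emb) ≫
      eqToHom (congrArg (fun k => (B.obj k).game) e.choose_spec)
  else empStrategy _ _

/-- The embedding of products induced by a morphism of families. -/
noncomputable def prodEmb (f : A ⟶ B) : famProd A ⟶ famProd B := pairing (prodEmbComp f)

/-- The projection of products induced by a morphism of families. -/
def prodPrj (f : A ⟶ B) : famProd B ⟶ famProd A :=
  pairing fun j => famProj B (f.fn j) ≫ (f.map j).prj

theorem prodEmbComp_apply (f : A ⟶ B) (j : A.Idx) :
    prodEmbComp f (f.fn j) = famProj A j ≫ (f.map j).emb := by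
  have e : ∃ j', f.fn j' = f.fn j := ⟨j, rfl⟩
  rw [prodEmbComp, dif_pos e]
  have key : ∀ j' (e' : f.fn j' = f.fn j), (famProj A j' ≫ (f.map j').emb) ≫
      eqToHom (congrArg (fun k => (B.obj k).game) e') = famProj A j ≫ (f.map j).emb := by
    intro j' e'
    obtain rfl := f.inj e'
    exact Category.comp_id _
  exact key _ e.choose_spec

theorem prodEmbComp_of_not (f : A ⟶ B) {h : B.Idx} (hh : ∀ j, f.fn j ≠ h) :
    prodEmbComp f h = empStrategy _ _ := by
  rw [prodEmbComp, dif_neg (by simpa using hh)]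

theorem prodEmb_proj (f : A ⟶ B) (h : B.Idx) : prodEmb f ≫ famProj B h = prodEmbComp f h :=
  pairing_proj _ h

theorem prodPrj_proj (f : A ⟶ B) (j : A.Idx) :
    prodPrj f ≫ famProj A j = famProj B (f.fn j) ≫ (f.map j).prj :=
  pairing_proj _ j

theorem famProd_ext {X : NegGame.{u}} {σ τ : X ⟶ famProd A}
    (h : ∀ i, σ ≫ famProj A i = τ ≫ famProj A i) : σ = τ := eq_of_proj h

theorem famProd_le {X : NegGame.{u}} {σ τ : X ⟶ famProd A}
    (h : ∀ i, σ ≫ famProj A i ≤ τ ≫ famProj A i) : σ ≤ τ := le_of_proj h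

theorem prodEmb_prodPrj (f : A ⟶ B) : prodEmb f ≫ prodPrj f = 𝟙 _ := by
  refine famProd_ext fun j => ?_
  rw [Category.assoc, prodPrj_proj, ← Category.assoc, prodEmb_proj, prodEmbComp_apply,
    Category.assoc, (f.map j).emb_prj, Category.comp_id, Category.id_comp]

theorem prodPrj_prodEmb (f : A ⟶ B) : prodPrj f ≫ prodEmb f ≤ 𝟙 _ := by
  refine famProd_le fun h => ?_
  rw [Category.assoc, prodEmb_proj, Category.id_comp]
  by_cases hh : ∃ j, f.fn j = h
  · obtain ⟨j, rfl⟩ := hh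
    rw [prodEmbComp_apply, ← Category.assoc, prodPrj_proj, Category.assoc]
    refine (comp_mono le_rfl (f.map j).prj_emb).trans ?_
    rw [Category.comp_id]
  · push Not at hh
    rw [prodEmbComp_of_not f hh, comp_empStrategy]
    exact empStrategy_le _

/-- The product functor on families of games and embeddings. -/
noncomputable def prodFunctor : FamInj.{u} EmbGame.{u} ⥤ EmbGame.{u} where
  obj A := ⟨famProd A⟩
  map f := ⟨prodEmb f, prodPrj f, prodEmb_prodPrj f, prodPrj_prodEmb f⟩
  map_id A := by
    refine GameEmb.ext (famProd_ext fun i => ?_) (famProd_ext fun i => ?_)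
    · refine (prodEmb_proj (𝟙 A) i).trans ((prodEmbComp_apply (𝟙 A) i).trans ?_)
      exact (Category.comp_id _).trans (Category.id_comp _).symm
    · refine (prodPrj_proj (𝟙 A) i).trans ?_
      exact (Category.comp_id _).trans (Category.id_comp _).symm
  map_comp {A B C} f g := by
    refine GameEmb.ext (famProd_ext fun k => ?_) (famProd_ext fun i => ?_)
    · change prodEmb (f ≫ g) ≫ famProj C k = (prodEmb f ≫ prodEmb g) ≫ famProj C k
      rw [Category.assoc, prodEmb_proj, prodEmb_proj]
      by_cases hk : ∃ h, g.fn h = k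
      · obtain ⟨h, rfl⟩ := hk
        rw [prodEmbComp_apply, ← Category.assoc, prodEmb_proj]
        by_cases hh : ∃ j, f.fn j = h
        · obtain ⟨j, rfl⟩ := hh
          rw [prodEmbComp_apply, Category.assoc]
          exact prodEmbComp_apply (f ≫ g) j
        · push Not at hh
          rw [prodEmbComp_of_not f hh, GameEmb.empStrategy_emb]
          exact prodEmbComp_of_not (f ≫ g) fun j e => hh j (g.inj e)
      · push Not at hk
        rw [prodEmbComp_of_not g hk, comp_empStrategy]
        exact prodEmbComp_of_not (f ≫ g) fun j => hk _
    · change prodPrj (f ≫ g) ≫ famProj A i = (prodPrj g ≫ prodPrj f) ≫ famProj A i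
      rw [Category.assoc, prodPrj_proj f, ← Category.assoc, prodPrj_proj g, Category.assoc]
      exact prodPrj_proj (f ≫ g) i

end ProdFunctor

/-! ### Models and quantification -/

section Models

universe a b c

variable {L : FirstOrder.Language.{a, b}} {V : Type c}

/-- Atomic formulas with variables in `α`. A first-order language with complementary pairs of
predicate symbols, among them the pair of `=` and `≠`, is given by a language `L` with one relation
symbol for each pair different from this one: the relation symbol is the positive member of the
pair, its complement is the negative member. The positive atomic formulas are `pos` and `ne`. -/
inductive Atom (L : FirstOrder.Language.{a, b}) (α : Type c)
  | pos {n : ℕ} (R : L.Relations n) (ts : Fin n → L.Term α)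
  | neg {n : ℕ} (R : L.Relations n) (ts : Fin n → L.Term α)
  | ne (s t : L.Term α)
  | eq (s t : L.Term α)

/-- The truth value of an atomic formula. -/
def Atom.Holds {α M : Type*} [L.Structure M] (v : α → M) : Atom L α → Prop
  | .pos R ts => FirstOrder.Language.Structure.RelMap R fun i => (ts i).realize v
  | .neg R ts => ¬ FirstOrder.Language.Structure.RelMap R fun i => (ts i).realize v
  | .ne s t => s.realize v ≠ t.realize v
  | .eq s t => s.realize v = t.realize v

/-- Renaming of variables. -/
def Atom.rename {α β : Type*} (g : α → β) : Atom L α → Atom L β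
  | .pos R ts => .pos R fun i => (ts i).relabel g
  | .neg R ts => .neg R fun i => (ts i).relabel g
  | .ne s t => .ne (s.relabel g) (t.relabel g)
  | .eq s t => .eq (s.relabel g) (t.relabel g)

theorem Atom.holds_rename {α β M : Type*} [L.Structure M] (g : α → β) (v : β → M)
    (a : Atom L α) : (a.rename g).Holds v ↔ a.Holds (v ∘ g) := by
  cases a <;> simp [Atom.rename, Atom.Holds, FirstOrder.Language.Term.realize_relabel]

/-- Models over the set of variables `X` that satisfy all formulas in `Θ`. -/
structure Model (X : Set V) (Θ : Set (Atom L X)) where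
  carrier : Type u
  str : L.Structure carrier
  val : X → carrier
  sat : ∀ φ ∈ Θ, φ.Holds val

attribute [instance] Model.str

variable {X : Set V} {Θ : Set (Atom L X)}

/-- Morphisms of models preserve the valuations, the truth of positive atomic formulas (hence they
are injective, as `≠` is preserved), and the function symbols. -/
@[ext] structure Model.Hom (M N : Model.{u} X Θ) where
  toFun : M.carrier → N.carrier
  map_val : ∀ y, N.val y = toFun (M.val y)
  map_ne : ∀ a b, a ≠ b → toFun a ≠ toFun b
  map_rel : ∀ {n : ℕ} (R : L.Relations n) (a : Fin n → M.carrier),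
    FirstOrder.Language.Structure.RelMap R a →
      FirstOrder.Language.Structure.RelMap R fun i => toFun (a i)
  map_fun : ∀ {n : ℕ} (g : L.Functions n) (a : Fin n → M.carrier),
    toFun (FirstOrder.Language.Structure.funMap g a) =
      FirstOrder.Language.Structure.funMap g fun i => toFun (a i)

/-- The category of models over `X` that satisfy all formulas in `Θ`. -/
instance : Category.{u} (Model.{u} X Θ) where
  Hom M N := Model.Hom M N
  id M := ⟨id, fun _ => rfl, fun _ _ h => h, fun _ _ h => h, fun _ _ => rfl⟩
  comp f g := ⟨g.toFun ∘ f.toFun, fun y => by rw [g.map_val, f.map_val]; rfl,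
    fun a b h => g.map_ne _ _ (f.map_ne _ _ h), fun R a h => g.map_rel R _ (f.map_rel R a h),
    fun h a => by rw [Function.comp_apply, f.map_fun, g.map_fun]; rfl⟩

/-- The formulas in `Θ`, with variables in `X`, as formulas with variables in `X ∪ {x}`. -/
def weaken (x : V) (Θ : Set (Atom L X)) : Set (Atom L ↥(insert x X)) :=
  Atom.rename (Set.inclusion (Set.subset_insert x X)) '' Θ

/-- The forgetful functor from models over `X ∪ {x}` to models over `X`. -/
def forgetVar (x : V) (Θ : Set (Atom L X)) : Model.{u} (insert x X) (weaken x Θ) ⥤ Model.{u} X Θ where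
  obj M := ⟨M.carrier, M.str, M.val ∘ Set.inclusion (Set.subset_insert x X), fun φ hφ =>
    (Atom.holds_rename _ _ φ).1 (M.sat _ ⟨φ, hφ, rfl⟩)⟩
  map f := ⟨f.toFun, fun y => f.map_val _, f.map_ne, f.map_rel, f.map_fun⟩

open Classical in
/-- The valuation `v[x ↦ l]`. -/
noncomputable def updateVal {M : Type*} (x : V) (v : X → M) (l : M) : ↥(insert x X) → M :=
  fun y => if h : (y : V) = x then l else v ⟨y, y.2.resolve_left h⟩

theorem updateVal_inclusion {M : Type*} {x : V} (hx : x ∉ X) (v : X → M) (l : M) :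
    updateVal x v l ∘ Set.inclusion (Set.subset_insert x X) = v := by
  funext y
  have : (y : V) ≠ x := fun h => hx (h ▸ y.2)
  simp [updateVal, this]

theorem updateVal_self {M : Type*} {x : V} (v : ↥(insert x X) → M) :
    updateVal x (v ∘ Set.inclusion (Set.subset_insert x X)) (v ⟨x, Set.mem_insert x X⟩) = v := by
  funext y
  by_cases h : (y : V) = x
  · have : y = ⟨x, Set.mem_insert x X⟩ := Subtype.ext h
    subst this
    simp [updateVal]
  · simp only [updateVal, h, dite_false]
    rfl

/-- The model `(L, v[x ↦ l])`. -/
noncomputable def Model.update {x : V} (hx : x ∉ X) (M : Model.{u} X Θ) (l : M.carrier) :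
    Model.{u} (insert x X) (weaken x Θ) :=
  ⟨M.carrier, M.str, updateVal x M.val l, by
    rintro _ ⟨φ, hφ, rfl⟩
    rw [Atom.holds_rename, updateVal_inclusion hx]
    exact M.sat φ hφ⟩

/-- The functor that sends a model `(L, v)` over `X` to the family of the models `(L, v[x ↦ l])`
over `X ∪ {x}`, indexed by the elements `l` of `L`. -/
noncomputable def addVar {x : V} (hx : x ∉ X) (Θ : Set (Atom L X)) :
    Model.{u} X Θ ⥤ FamInj.{u} (Model.{u} (insert x X) (weaken x Θ)) where
  obj M := ⟨M.carrier, M.update hx⟩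
  map {M N} f := ⟨f.toFun, fun a b h => not_imp_not.1 (f.map_ne a b) h, fun l =>
    ⟨f.toFun, fun y => by
      by_cases h : (y : V) = x
      · simp [Model.update, updateVal, h]
      · simpa [Model.update, updateVal, h] using f.map_val _, f.map_ne, f.map_rel, f.map_fun⟩⟩

/-- The family of games `∀x. F = prod ∘ FamInj(F) ∘ add_x`. -/
noncomputable def forallFam {x : V} (hx : x ∉ X) (Θ : Set (Atom L X))
    (F : Model.{u} (insert x X) (weaken x Θ) ⥤ EmbGame.{u}) : Model.{u} X Θ ⥤ EmbGame.{u} :=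
  addVar hx Θ ⋙ FamInj.mapFunctor F ⋙ prodFunctor

section Forall

variable {x : V} (hx : x ∉ X)

/-- The family of the games `F (L, v[x ↦ l])`, for `l` in `L`. -/
noncomputable abbrev famAt (F : Model.{u} (insert x X) (weaken x Θ) ⥤ EmbGame.{u})
    (M : Model.{u} X Θ) : FamInj.{u} EmbGame.{u} :=
  (FamInj.mapFunctor.{u} F).obj ((addVar.{u} hx Θ).obj M)

/-- The product, over the elements `l` of `L`, of the strategies `σ (L, v[x ↦ l])`. -/
noncomputable def forallApp {F G : Model.{u} (insert x X) (weaken x Θ) ⥤ EmbGame.{u}}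
    (σ : UniformWinning F G) (M : Model.{u} X Θ) : famProd (famAt hx F M) ⟶ famProd (famAt hx G M) :=
  pairing fun l => famProj (famAt hx F M) l ≫ σ.app (M.update hx l)

theorem forallApp_proj {F G : Model.{u} (insert x X) (weaken x Θ) ⥤ EmbGame.{u}}
    (σ : UniformWinning F G) (M : Model.{u} X Θ) (l : M.carrier) :
    forallApp hx σ M ≫ famProj (famAt hx G M) l =
      famProj (famAt hx F M) l ≫ σ.app (M.update hx l) := pairing_proj _ l

theorem forallApp_uniform {F G : Model.{u} (insert x X) (weaken x Θ) ⥤ EmbGame.{u}}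
    (σ : UniformWinning F G) {M N : Model.{u} X Θ} (f : M ⟶ N) :
    forallApp hx σ M ≫ prodEmb ((FamInj.mapFunctor.{u} G).map ((addVar.{u} hx Θ).map f)) ≤
      prodEmb ((FamInj.mapFunctor.{u} F).map ((addVar.{u} hx Θ).map f)) ≫ forallApp hx σ N := by
  set p := (addVar.{u} hx Θ).map f
  set g := (FamInj.mapFunctor.{u} G).map p
  set e := (FamInj.mapFunctor.{u} F).map p
  refine famProd_le fun (k : N.carrier) => ?_
  have h1 : (prodEmb e ≫ forallApp hx σ N) ≫ famProj (famAt hx G N) k =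
      prodEmbComp e k ≫ σ.app (N.update hx k) := by
    rw [Category.assoc]
    refine (congrArg (prodEmb e ≫ ·) (forallApp_proj hx σ N k)).trans ?_
    exact (Category.assoc _ _ _).symm.trans
      (congrArg (· ≫ σ.app (N.update hx k)) (prodEmb_proj e k))
  have h2 : (forallApp hx σ M ≫ prodEmb g) ≫ famProj (famAt hx G N) k =
      forallApp hx σ M ≫ prodEmbComp g k :=
    (Category.assoc _ _ _).trans (congrArg (forallApp hx σ M ≫ ·) (prodEmb_proj g k))
  refine h2.le.trans (le_trans ?_ h1.ge)
  by_cases hk : ∃ l, f.toFun l = k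
  · obtain ⟨l, rfl⟩ := hk
    refine (comp_mono le_rfl (prodEmbComp_apply g l).le).trans
      (le_trans ?_ (comp_mono (prodEmbComp_apply e l).ge le_rfl))
    have h3 : forallApp hx σ M ≫ famProj (famAt hx G M) l ≫ (G.map (p.map l)).emb =
        famProj (famAt hx F M) l ≫ σ.app (M.update hx l) ≫ (G.map (p.map l)).emb :=
      (Category.assoc _ _ _).symm.trans ((congrArg (· ≫ (G.map (p.map l)).emb)
        (forallApp_proj hx σ M l)).trans (Category.assoc _ _ _))
    refine h3.le.trans ((comp_mono le_rfl (σ.uniform (p.map l))).trans ?_)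
    exact (Category.assoc _ _ _).ge
  · push Not at hk
    refine (comp_mono le_rfl (prodEmbComp_of_not g hk).le).trans ?_
    rw [comp_empStrategy]
    exact empStrategy_le _

/-- The functor `∀x`. On a family of games `F` it is `prod ∘ FamInj(F) ∘ add_x`, and on a uniform
winning strategy `σ` it is given by the products of the strategies `σ (L, v[x ↦ l])`. -/
noncomputable def forallFunctor (Θ : Set (Atom L X)) :
    UGames.{u} (Model.{u} (insert x X) (weaken x Θ)) ⥤ UGames.{u} (Model.{u} X Θ) where
  obj F := ⟨forallFam hx Θ F.fam⟩
  map σ := ⟨forallApp hx σ, fun _ _ f => forallApp_uniform hx σ f, fun M => pairing_winning fun l =>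
    comp_winning (proj_winning _ l) (σ.winning (M.update hx l))⟩
  map_id F := by
    refine UniformWinning.ext (funext fun M => famProd_ext fun l => ?_)
    refine (forallApp_proj hx (𝟙 F) M l).trans ?_
    exact (Category.comp_id _).trans (Category.id_comp _).symm
  map_comp {F G H} σ τ := by
    refine UniformWinning.ext (funext fun M => famProd_ext fun l => ?_)
    refine (forallApp_proj hx (σ ≫ τ) M l).trans (Eq.symm ?_)
    refine (Category.assoc (forallApp hx σ M) (forallApp hx τ M) _).trans ?_
    refine (congrArg (forallApp hx σ M ≫ ·) (forallApp_proj hx τ M l)).trans ?_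
    refine (Category.assoc _ _ _).symm.trans ?_
    refine (congrArg (· ≫ τ.app (M.update hx l)) (forallApp_proj hx σ M l)).trans ?_
    exact Category.assoc _ _ _

theorem update_forget (M : Model.{u} (insert x X) (weaken x Θ)) :
    ((forgetVar x Θ).obj M).update hx (M.val ⟨x, Set.mem_insert x X⟩) = M := by
  have h := updateVal_self M.val
  cases M
  simp only [Model.update, forgetVar, Model.mk.injEq, heq_eq_eq, true_and]
  exact h

/-- At a model `(L, v)` over `X ∪ {x}`, the projection `π_{v(x)}` from the product of the games
`F (L, (v - x)[x ↦ l])`, for `l` in `L`, to its member with index `v(x)`, which is `F (L, v)`. -/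
noncomputable def projAtVal (F : UGames.{u} (Model.{u} (insert x X) (weaken x Θ)))
    (M : Model.{u} (insert x X) (weaken x Θ)) :
    ((forallFam hx Θ F.fam).obj ((forgetVar x Θ).obj M)).game ⟶ (F.fam.obj M).game :=
  famProj (famAt hx F.fam ((forgetVar x Θ).obj M)) (M.val ⟨x, Set.mem_insert x X⟩) ≫
    eqToHom (congrArg (fun N => (F.fam.obj N).game) (update_forget hx M))

end Forall

end Models

end WS1

universe u a b c

/-! The adjunction is the one between a diagonal and projections, taken pointwise over the models.
The counit at `F` is the projection `π_{v(x)}` at `(L,v)`. The unit at `G` is, at `(L,v)`, the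
diagonal from `G(L,v)` to `∏_l G(U_x(L,v[x↦l]))`. All factors of this product are `G(L,v)` itself,
because `x ∉ X` and forgetting `x` therefore undoes the update. A strategy into a product is
determined by its composites with the projections, and inclusion of strategies can also be tested
there (`famProd_ext`, `famProd_le`). So naturality and the triangle identities become short
computations with one projection at a time.

The mathematical content lies in uniformity, that is, in lax naturality along a morphism `f : (L,v)
→ (L',v')`. By `prodEmbComp_apply` and `prodEmbComp_of_not`, the embedding of products induced by
`f` has the component `π_l` followed by an embedding at an index `f(l)`, and the empty strategy at
every index outside the image of `f`. For the counit the relevant index is `v'(x)`, which equals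
`f(v(x))` and so always lies in the image. Hence the square commutes exactly (`projAtVal_uniform`).
For the unit every index of `L'` matters (`diagonal_uniform`). At `f(l)` the two sides agree.
Elsewhere one side is empty, and the inclusion holds because the empty strategy is the least one;
here equality fails in general, and only the lax condition survives.

The remaining work is bookkeeping of equalities of objects. The models `U_x(L,v[x↦l])` and `(L,v)`,
and likewise `(L,v[x↦v(x)])` and `(L,v)`, are equal, but not definitionally, so the games over them
are related by `eqToHom`. These canonical morphisms are copycat strategies after substitution, hence
winning. They commute exactly with every uniform strategy (`UniformWinning.eqToHom_app`), and on
models they are the identity on elements (`Model.toFun_eqToHom`). In both triangle identities the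
leftover canonical morphisms compose to a canonical endomorphism, which is the identity. -/

namespace WS1

universe v w

/-! ### Transport of games and strategies along equalities of objects. -/

section Transport

variable {𝒞 : Type v} [Category.{w} 𝒞]

/-- After substitution both canonical morphisms are identities and the hypothesis says `g = f`. The
lemma carries a square of models over to a square of games. It is not mere functoriality: `F` takes
values in embedding-projection pairs, whereas the canonical morphisms in the conclusion are
strategies, given by equalities of the underlying games. -/
theorem emb_comp_eqToHom (F : 𝒞 ⥤ EmbGame.{u}) {c c' d d' : 𝒞} (hc : c = c') (hd : d = d')
    {g : c ⟶ d} {f : c' ⟶ d'} (h : g ≫ eqToHom hd = eqToHom hc ≫ f) :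
    (F.map g).emb ≫ eqToHom (congrArg (fun c => (F.obj c).game) hd) =
      eqToHom (congrArg (fun c => (F.obj c).game) hc) ≫ (F.map f).emb := by
  subst hc hd
  obtain rfl : g = f := by simpa using h
  exact (Category.comp_id _).trans (Category.id_comp _).symm

/-- The same square with its canonical sides inverted. The diagonal needs this direction, because
its components lead from `G(L,v)` to `G(U_x(L,v[x↦l]))`, while the projection `π_{v(x)}` uses the
other one. -/
theorem eqToHom_comp_emb (F : 𝒞 ⥤ EmbGame.{u}) {c c' d d' : 𝒞} (hc : c = c') (hd : d = d')
    {g : c ⟶ d} {f : c' ⟶ d'} (h : g ≫ eqToHom hd = eqToHom hc ≫ f) :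
    eqToHom (congrArg (fun c => (F.obj c).game) hc.symm) ≫ (F.map g).emb =
      (F.map f).emb ≫ eqToHom (congrArg (fun c => (F.obj c).game) hd.symm) := by
  subst hc hd
  obtain rfl : g = f := by simpa using h
  exact (Category.id_comp _).trans (Category.comp_id _).symm

/-- Up to substitution this is the identity, which is a copycat strategy. -/
theorem eqToHom_winning {A B : NegGame.{u}} (h : A = B) :
    Strategy.IsWinning (A := lolli A B) (eqToHom h) := by
  subst h
  exact copycat_winning (copyMap_id A)

/-- Uniformity yields only an inclusion along a general morphism. Along an equality of objects the
square commutes exactly, since it becomes a square of identities with `σ` on both sides. Both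
naturality proofs rest on this. -/
theorem UniformWinning.eqToHom_app {F G : 𝒞 ⥤ EmbGame.{u}} (σ : UniformWinning F G) {c d : 𝒞}
    (h : c = d) :
    eqToHom (congrArg (fun c => (F.obj c).game) h) ≫ σ.app d =
      σ.app c ≫ eqToHom (congrArg (fun c => (G.obj c).game) h) := by
  subst h
  exact (Category.id_comp _).trans (Category.comp_id _).symm

end Transport

/-! ### Updating and forgetting the value of `x` in a model. -/

section Models

variable {L : FirstOrder.Language.{a, b}} {V : Type c} {X : Set V} {Θ : Set (Atom L X)}

/-- The canonical morphism between two models that differ at most in their valuations is the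
identity on the elements. -/
theorem Model.toFun_eqToHom {α : Type u} {s : L.Structure α} {v v' : X → α}
    {h : ∀ φ ∈ Θ, φ.Holds v} {h' : ∀ φ ∈ Θ, φ.Holds v'}
    (e : (⟨α, s, v, h⟩ : Model.{u} X Θ) = ⟨α, s, v', h'⟩) :
    Model.Hom.toFun (eqToHom e) = id := by
  -- The two models share their carrier and their structure by the form of the statement. This makes
  -- the equation with `id` well typed and reduces the equality of models to that of the valuations.
  obtain rfl : v = v' := by simpa using e
  rfl

variable {x : V} (hx : x ∉ X)

/-- As `x ∉ X`, overwriting the value at `x` does not affect the values on `X`. This makes all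
factors in the target of the diagonal copies of one game. The opposite composite is `update_forget`,
which recovers a model only when the new value is its own value of `x`. -/
theorem forget_update (M : Model.{u} X Θ) (l : M.carrier) :
    (forgetVar x Θ).obj (M.update hx l) = M := by
  have h := updateVal_inclusion hx M.val l
  cases M
  simp only [Model.update, forgetVar, Model.mk.injEq, heq_eq_eq, true_and]
  exact h

theorem update_val_self (M : Model.{u} X Θ) (l : M.carrier) :
    (M.update hx l).val ⟨x, Set.mem_insert x X⟩ = l := by
  simp [Model.update, updateVal]

/-- A morphism of models is determined by its underlying map, and on both sides this map is that of
`f`. The lemma provides the square of models behind the uniformity of the diagonal at an index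
`f(l)`. -/
theorem eqToHom_map_addVar {M N : Model.{u} X Θ} (f : M ⟶ N) (l : M.carrier) :
    (forgetVar x Θ).map (((addVar.{u} hx Θ).map f).map l) ≫ eqToHom (forget_update hx N (f.toFun l)) =
      eqToHom (forget_update hx M l) ≫ f := by
  refine Model.Hom.ext ?_
  -- Updating and forgetting keep the carrier and the structure definitionally, so both models have
  -- the shape required by `Model.toFun_eqToHom`.
  have h1 : Model.Hom.toFun (eqToHom (forget_update hx M l)) = id := Model.toFun_eqToHom _
  have h2 : Model.Hom.toFun (eqToHom (forget_update hx N (f.toFun l))) = id :=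
    Model.toFun_eqToHom _
  change Model.Hom.toFun (eqToHom (forget_update hx N (f.toFun l))) ∘ f.toFun =
    f.toFun ∘ Model.Hom.toFun (eqToHom (forget_update hx M l))
  rw [h1, h2]
  rfl

/-- Again both sides have the underlying map of `f`. The equality `h` is a separate hypothesis
because `addVar` produces the update at `f(v(x))`, which agrees with the value of `x` in `N` only
propositionally. -/
theorem addVar_map_forget {M N : Model.{u} (insert x X) (weaken x Θ)} (f : M ⟶ N)
    (h : ((forgetVar x Θ).obj N).update hx (f.toFun (M.val ⟨x, Set.mem_insert x X⟩)) = N) :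
    ((addVar.{u} hx Θ).map ((forgetVar x Θ).map f)).map (M.val ⟨x, Set.mem_insert x X⟩) ≫
      eqToHom h = eqToHom (update_forget hx M) ≫ f := by
  refine Model.Hom.ext ?_
  have h1 : Model.Hom.toFun (eqToHom (update_forget hx M)) = id := Model.toFun_eqToHom _
  have h2 : Model.Hom.toFun (eqToHom h) = id := Model.toFun_eqToHom _
  change Model.Hom.toFun (eqToHom h) ∘ f.toFun =
    f.toFun ∘ Model.Hom.toFun (eqToHom (update_forget hx M))
  rw [h1, h2]
  rfl

/-! ### The counit: projections at the value of `x`, and their uniformity. -/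

/-- The projection `π_{v(x)}`, at any index known to be the value of `x`. -/
theorem projAtVal_eq (F : UGames.{u} (Model.{u} (insert x X) (weaken x Θ)))
    (M : Model.{u} (insert x X) (weaken x Θ)) {l : M.carrier}
    (h : M.val ⟨x, Set.mem_insert x X⟩ = l)
    (e : ((forgetVar x Θ).obj M).update hx l = M) :
    projAtVal hx F M = famProj (famAt hx F.fam ((forgetVar x Θ).obj M)) l ≫
      eqToHom (congrArg (fun N => (F.fam.obj N).game) e) := by
  subst h
  -- The equality `e` and the one used in `projAtVal` now prove the same proposition, so the two
  -- canonical morphisms coincide.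
  rfl

/-- At `(L, v[x ↦ l])`, the projection `π_{v(x)}` is `π_l`. -/
theorem projAtVal_update (F : UGames.{u} (Model.{u} (insert x X) (weaken x Θ)))
    (M : Model.{u} X Θ) (l : M.carrier) :
    projAtVal hx F (M.update hx l) =
      eqToHom (congrArg (fun N => ((forallFam hx Θ F.fam).obj N).game) (forget_update hx M l)) ≫
        famProj (famAt hx F.fam M) l := by
  -- The model `U_x(L,v[x↦l])` and its index, the value of `x`, are replaced by variables `N` and
  -- `k`, since the actual equality with `M` cannot be substituted. The indices belong to the
  -- carriers of `N` and `M`, hence the heterogeneous equality. Once `N` and `k` are identified with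
  -- `M` and `l`, both canonical morphisms are identities.
  have key : ∀ (N : Model.{u} X Θ) (k : N.carrier) (hN : N = M) (_ : HEq k l)
      (e : N.update hx k = M.update hx l), famProj (famAt hx F.fam N) k ≫
        eqToHom (congrArg (fun N => (F.fam.obj N).game) e) =
      eqToHom (congrArg (fun N => ((forallFam hx Θ F.fam).obj N).game) hN) ≫
        famProj (famAt hx F.fam M) l := by
    rintro N k rfl hk e
    obtain rfl := eq_of_heq hk
    exact (Category.comp_id _).trans (Category.id_comp _).symm
  exact key _ _ (forget_update hx M l) (heq_of_eq (update_val_self hx M l)) (update_forget hx _)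

/-- The value of `x` in the target of `f` is `f(v(x))`, an index in the image of `f`. There the
embedding of products is `π_{v(x)}` followed by an embedding, so the lax square commutes exactly;
the empty components of the embedding are never seen. -/
theorem projAtVal_uniform (F : UGames.{u} (Model.{u} (insert x X) (weaken x Θ))) :
    IsUniform (F := forgetVar x Θ ⋙ forallFam hx Θ F.fam) (G := F.fam) (projAtVal hx F) := by
  intro M N f
  -- The index is `l = v(x)`. Below, `p.map l` is `f` regarded as a morphism from `(L,v[x↦l])` to
  -- `(L',v'[x↦f(l)])`, and `e` is the induced morphism of families of games.
  set l := M.val ⟨x, Set.mem_insert x X⟩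
  set p := (addVar.{u} hx Θ).map ((forgetVar x Θ).map f)
  set e := (FamInj.mapFunctor.{u} F.fam).map p
  -- Preservation of valuations at `x` itself puts the relevant index in the image of `f`.
  have hv : N.val ⟨x, Set.mem_insert x X⟩ = f.toFun l := f.map_val _
  have hN : ((forgetVar x Θ).obj N).update hx (f.toFun l) = N := hv ▸ update_forget hx N
  have h1 : (F.fam.map (p.map l)).emb ≫ eqToHom (congrArg (fun N => (F.fam.obj N).game) hN) =
      eqToHom (congrArg (fun N => (F.fam.obj N).game) (update_forget hx M)) ≫
        (F.fam.map f).emb :=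
    emb_comp_eqToHom F.fam (update_forget hx M) hN (addVar_map_forget hx f hN)
  have h2 : prodEmb e ≫ projAtVal hx F N = projAtVal hx F M ≫ (F.fam.map f).emb := by
    -- The projection is rewritten at the index `f(l)` in place of the value of `x`, which is the
    -- form in which `prodEmbComp_apply` computes the component of the embedding.
    refine (congrArg (prodEmb e ≫ ·) (projAtVal_eq hx F N hv hN)).trans ?_
    refine (Category.assoc _ _ _).symm.trans ?_
    refine (congrArg (· ≫ eqToHom (congrArg (fun N => (F.fam.obj N).game) hN))
      ((prodEmb_proj e (f.toFun l)).trans (prodEmbComp_apply e l))).trans ?_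
    refine (Category.assoc _ _ _).trans ?_
    refine (congrArg (famProj (famAt hx F.fam ((forgetVar x Θ).obj M)) l ≫ ·) h1).trans ?_
    exact (Category.assoc _ _ _).symm
  exact h2.ge

theorem comp_eqToHom_winning {A B C : NegGame.{u}} {σ : A ⟶ B} (hσ : Strategy.IsWinning σ)
    (h : B = C) : Strategy.IsWinning (A := lolli A C) (σ ≫ eqToHom h) :=
  comp_winning hσ (eqToHom_winning h)

/-- The projections `π_{v(x)}` as a uniform winning strategy from `∀x. F`, weakened by `x`, to
`F`. -/
noncomputable def forallCounit (F : UGames.{u} (Model.{u} (insert x X) (weaken x Θ))) :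
    (reindex.{u} (forgetVar.{u} x Θ)).obj ((forallFunctor.{u} hx Θ).obj F) ⟶ F :=
  (⟨projAtVal hx F, projAtVal_uniform hx F,
    fun _ => comp_eqToHom_winning (proj_winning _ _) _⟩ :
      UniformWinning (forgetVar x Θ ⋙ forallFam hx Θ F.fam) F.fam)

/-! ### The unit: diagonals and their uniformity. -/

/-- The diagonal from `G (L, v)` to the product of the games `G (L, v[x ↦ l] - x) = G (L, v)`, for
`l` in `L`. -/
noncomputable def diagonal (G : UGames.{u} (Model.{u} X Θ)) (M : Model.{u} X Θ) :
    (G.fam.obj M).game ⟶ famProd (famAt hx (forgetVar x Θ ⋙ G.fam) M) :=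
  pairing fun l : M.carrier =>
    eqToHom (congrArg (fun N => (G.fam.obj N).game) (forget_update hx M l).symm)

theorem diagonal_proj (G : UGames.{u} (Model.{u} X Θ)) (M : Model.{u} X Θ) (l : M.carrier) :
    diagonal hx G M ≫ famProj (famAt hx (forgetVar x Θ ⋙ G.fam) M) l =
      eqToHom (congrArg (fun N => (G.fam.obj N).game) (forget_update hx M l).symm) :=
  pairing_proj _ l

/-- The inclusion is tested at each index `k` of the larger model. If `k = f(l)`, both sides are the
embedding `G(f)` up to transport. If `k` is not in the image, the left side is empty while the right
side is still `G(f)` up to transport, so in general the inclusion is strict and the unit is only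
lax. -/
theorem diagonal_uniform (G : UGames.{u} (Model.{u} X Θ)) :
    IsUniform (F := G.fam) (G := forallFam hx Θ (forgetVar x Θ ⋙ G.fam)) (diagonal hx G) := by
  intro M N f
  set p := (addVar.{u} hx Θ).map f
  set e := (FamInj.mapFunctor.{u} (forgetVar x Θ ⋙ G.fam)).map p
  change diagonal hx G M ≫ prodEmb e ≤ (G.fam.map f).emb ≫ diagonal hx G N
  -- Inclusion of strategies into a product can be tested after the projections, because each
  -- nonempty play lies over a single factor.
  refine famProd_le fun (k : N.carrier) => ?_
  have h1 : ((G.fam.map f).emb ≫ diagonal hx G N) ≫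
      famProj (famAt hx (forgetVar x Θ ⋙ G.fam) N) k = (G.fam.map f).emb ≫
        eqToHom (congrArg (fun N => (G.fam.obj N).game) (forget_update hx N k).symm) :=
    (Category.assoc _ _ _).trans
      (congrArg ((G.fam.map f).emb ≫ ·) (diagonal_proj hx G N k))
  have h2 : (diagonal hx G M ≫ prodEmb e) ≫ famProj (famAt hx (forgetVar x Θ ⋙ G.fam) N) k =
      diagonal hx G M ≫ prodEmbComp e k :=
    (Category.assoc _ _ _).trans (congrArg (diagonal hx G M ≫ ·) (prodEmb_proj e k))
  refine h2.le.trans (le_trans ?_ h1.ge)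
  by_cases hk : ∃ l, f.toFun l = k
  · obtain ⟨l, rfl⟩ := hk
    have h3 : eqToHom (congrArg (fun N => (G.fam.obj N).game) (forget_update hx M l).symm) ≫
        (G.fam.map ((forgetVar x Θ).map (p.map l))).emb = (G.fam.map f).emb ≫
        eqToHom (congrArg (fun N => (G.fam.obj N).game)
          (forget_update hx N (f.toFun l)).symm) :=
      eqToHom_comp_emb G.fam (forget_update hx M l) (forget_update hx N (f.toFun l))
        (eqToHom_map_addVar hx f l)
    -- At an index in the image of `f` there is equality: `π_l` cancels the diagonal, and `h3` moves
    -- the remaining transport across the embedding.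
    refine le_of_eq ?_
    refine (congrArg (diagonal hx G M ≫ ·) (prodEmbComp_apply e l)).trans ?_
    refine (Category.assoc _ _ _).symm.trans ?_
    exact (congrArg (· ≫ (G.fam.map ((forgetVar x Θ).map (p.map l))).emb)
      (diagonal_proj hx G M l)).trans h3
  · push Not at hk
    -- Outside the image of `f` the component of the embedding is the empty strategy. Its composite
    -- with the diagonal is again empty, and hence the least strategy.
    refine (comp_mono le_rfl (prodEmbComp_of_not e hk).le).trans ?_
    rw [comp_empStrategy]
    exact empStrategy_le _

/-- The diagonals as a uniform winning strategy. -/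
noncomputable def forallUnit (G : UGames.{u} (Model.{u} X Θ)) :
    G ⟶ (forallFunctor.{u} hx Θ).obj ((reindex.{u} (forgetVar.{u} x Θ)).obj G) :=
  (⟨diagonal hx G, diagonal_uniform hx G,
    fun _ => pairing_winning fun _ => eqToHom_winning _⟩ :
      UniformWinning G.fam (forallFam hx Θ (forgetVar x Θ ⋙ G.fam)))

/-! ### Naturality of the counit and of the unit. -/

/-- Followed by `π_l`, the strategy `∀x.σ` is `π_l` followed by `σ` at `(L,v[x↦l])`. With `l = v(x)`
it remains to replace `(L,v[x↦v(x)])` by `(L,v)`, and `σ` commutes with this transport. -/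
theorem forallCounit_naturality {F G : UGames.{u} (Model.{u} (insert x X) (weaken x Θ))}
    (σ : F ⟶ G) : (reindex.{u} (forgetVar.{u} x Θ)).map ((forallFunctor.{u} hx Θ).map σ) ≫
      forallCounit hx G = forallCounit hx F ≫ σ := by
  refine UniformWinning.ext (funext fun M => ?_)
  set l := M.val ⟨x, Set.mem_insert x X⟩
  set N := (forgetVar x Θ).obj M
  have h1 := UniformWinning.eqToHom_app σ (update_forget hx M)
  change forallApp hx σ N ≫ famProj (famAt hx G.fam N) l ≫ _ =
    (famProj (famAt hx F.fam N) l ≫ _) ≫ σ.app M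
  refine (Category.assoc _ _ _).symm.trans (Eq.trans ?_ (Category.assoc _ _ _).symm)
  refine (congrArg (· ≫ eqToHom _) (forallApp_proj hx σ N l)).trans ?_
  exact (Category.assoc _ _ _).trans (congrArg (famProj (famAt hx F.fam N) l ≫ ·) h1.symm)

/-- After `π_l` both composites consist of one component of `τ` and one transport along `(L,v) =
U_x(L,v[x↦l])`, in opposite orders. They agree because `τ` commutes with transport. -/
theorem forallUnit_naturality {G H : UGames.{u} (Model.{u} X Θ)} (τ : G ⟶ H) :
    τ ≫ forallUnit hx H = forallUnit hx G ≫
      (forallFunctor.{u} hx Θ).map ((reindex.{u} (forgetVar.{u} x Θ)).map τ) := by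
  refine UniformWinning.ext (funext fun M => famProd_ext fun (l : M.carrier) => ?_)
  set τ' := (reindex.{u} (forgetVar.{u} x Θ)).map τ
  have h1 := UniformWinning.eqToHom_app τ (forget_update hx M l).symm
  refine (Category.assoc (τ.app M) (diagonal hx H M) _).trans ?_
  refine (congrArg (τ.app M ≫ ·) (diagonal_proj hx H M l)).trans (h1.symm.trans (Eq.symm ?_))
  refine (Category.assoc (diagonal hx G M) (forallApp hx τ' M) _).trans ?_
  refine (congrArg (diagonal hx G M ≫ ·) (forallApp_proj hx τ' M l)).trans ?_
  refine (Category.assoc _ _ _).symm.trans ?_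
  exact congrArg (· ≫ τ'.app (M.update hx l)) (diagonal_proj hx G M l)

/-! ### The triangle identities and the adjunction. -/

/-- The projection to `v(x)` after the diagonal is a transport from `G(U_x(L,v))` to the factor at
`v(x)`. The counit then transports back to `G(U_x(L,v))`, and the round trip is the identity. -/
theorem forall_left_triangle (G : UGames.{u} (Model.{u} X Θ)) :
    (reindex.{u} (forgetVar.{u} x Θ)).map (forallUnit hx G) ≫
      forallCounit hx ((reindex.{u} (forgetVar.{u} x Θ)).obj G) = 𝟙 _ := by
  refine UniformWinning.ext (funext fun M => ?_)
  set N := (forgetVar x Θ).obj M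
  change diagonal hx G N ≫ famProj (famAt hx (forgetVar x Θ ⋙ G.fam) N)
    (M.val ⟨x, Set.mem_insert x X⟩) ≫ _ = 𝟙 (G.fam.obj N).game
  refine (Category.assoc _ _ _).symm.trans ?_
  refine (congrArg (· ≫ eqToHom _) (diagonal_proj hx G N _)).trans ?_
  exact (eqToHom_trans _ _).trans (eqToHom_refl _ _)

/-- After `π_l` the diagonal contributes only a transport, and the counit is evaluated at
`(L,v[x↦l])`. There it is `π_l` preceded by the opposite transport (`projAtVal_update`). The
transports cancel and `π_l` remains, as for the identity. -/
theorem forall_right_triangle (F : UGames.{u} (Model.{u} (insert x X) (weaken x Θ))) :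
    forallUnit hx ((forallFunctor.{u} hx Θ).obj F) ≫
      (forallFunctor.{u} hx Θ).map (forallCounit hx F) = 𝟙 _ := by
  refine UniformWinning.ext (funext fun M => famProd_ext fun (l : M.carrier) => ?_)
  set D := diagonal hx ((forallFunctor.{u} hx Θ).obj F) M
  refine (Category.assoc D (forallApp hx (forallCounit hx F) M) _).trans ?_
  refine (congrArg (D ≫ ·) (forallApp_proj hx (forallCounit hx F) M l)).trans ?_
  refine (Category.assoc _ _ _).symm.trans ?_
  refine (congrArg (· ≫ projAtVal hx F (M.update hx l)) (diagonal_proj hx _ M l)).trans ?_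
  refine (congrArg (eqToHom _ ≫ ·) (projAtVal_update hx F M l)).trans ?_
  refine (Category.assoc _ _ _).symm.trans ?_
  exact congrArg (· ≫ famProj (famAt hx F.fam M) l)
    ((eqToHom_trans _ _).trans (eqToHom_refl _ _))

/-- The universal quantifier is right adjoint to weakening. -/
noncomputable def forallAdjunction (Θ : Set (Atom L X)) :
    reindex.{u} (forgetVar.{u} x Θ) ⊣ forallFunctor.{u} hx Θ :=
  Adjunction.mkOfUnitCounit
    { unit := ⟨forallUnit hx, fun _ _ τ => forallUnit_naturality hx τ⟩
      counit := ⟨forallCounit hx, fun _ _ σ => forallCounit_naturality hx σ⟩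
      left_triangle := by
        ext1
        funext G
        -- The middle factor removed here is the component of the associator of functors that occurs
        -- in the triangle identity; it is an identity.
        refine (congrArg (_ ≫ ·) (Category.id_comp _)).trans ?_
        exact forall_left_triangle hx G
      right_triangle := by
        ext1
        funext F
        refine (congrArg (_ ≫ ·) (Category.id_comp _)).trans ?_
        exact forall_right_triangle hx F }

end Models

end WS1

theorem mainTheorem8 {L : FirstOrder.Language.{a, b}} {V : Type c} (X : Set V) (x : V)
    (hx : x ∉ X) (Θ : Set (WS1.Atom L X)) :
    ∃ adj : WS1.reindex.{u} (WS1.forgetVar.{u} x Θ) ⊣ WS1.forallFunctor.{u} hx Θ,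
      ∀ (F : WS1.UGames.{u} (WS1.Model.{u} (insert x X : Set V) (WS1.weaken x Θ)))
        (M : WS1.Model.{u} (insert x X : Set V) (WS1.weaken x Θ)),
        (adj.counit.app F).app M = WS1.projAtVal hx F M :=
  -- The adjunction is built from its unit and counit, so its counit is by definition the prescribed
  -- family of projections.
  ⟨WS1.forallAdjunction hx Θ, fun _ _ => rfl⟩
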